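/- Let $A$ be an indeterminate, $d=-A^2-A^{-2}$, and $\Delta_n=(-1)^n\frac{A^{2n+2}-A^{-2n-2}}{A^2-A^{-2}}\in\mathbb{Q}(A)$. Evaluate a crossingless closed diagram in the annulus by $d^k\zeta^m\in\mathbb{Q}(A)[\zeta]$, where $k$ and $m$ are the numbers of its homotopically trivial and non-trivial circles, and a crossingless closed diagram in the plane by $d^{k}$, where $k$ is the number of its circles; extend both evaluations linearly over $\mathbb{Q}(A)$. Let $S_k\in\mathbb{Q}(A)[\zeta]$ be the Chebyshev polynomials of the second kind, $S_0=1$, $S_1=\zeta$, $S_{k+1}=\zeta S_k-S_{k-1}$. Let $f_n$ be the $n$-th Jones–Wenzl idempotent, that is, $f_n=\frac{1}{\prod_{m=1}^n(1+q+\cdots+q^{m-1})}\sum_{\pi\in\mathfrak{S}_n}A^{3|\pi|}b_\pi$ with $q=A^4$, $\mathfrak{S}_n$ the symmetric group, $|\pi|$ the number of inversions of $\pi$, and $b_\pi$ the minimal positive braid with permutation $\pi$, each crossing of the strands $i,i+1$ being expanded as $A\cdot\mathbb{1}+A^{-1}e_i$. For natural numbers $x,y,z\ge 0$ consider the theta graph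 with edges $a,b,c$ that consist of $y+z$, $x+z$, $x+y$ parallel strands and carry the idempotents $f_{y+z}$, $f_{x+z}$, $f_{x+y}$; at each of the two vertices $y$ strands run between $a$ and $c$, $x$ strands between $b$ and $c$, and $z$ strands between $a$ and $b$. Let $\Gamma_{\mathbb{R}^2}(x,y,z)\in\mathbb{Q}(A)$ be its evaluation in the plane. Embed it in the annulus so that the complementary region between the edges $a$ and $b$ is a disc, while the other two regions, both adjacent to the edge $c$, contain the two ends of the annulus (so that the curve formed by $c$ and $a$ goes once around the annulus), and let $\Gamma_{Ann}(x,y,z)\in\mathbb{Q}(A)[\zeta]$ be its evaluation in the annulus. Then $\Delta_{x+y}\neq0$ and $$\Gamma_{Ann}(x,y,z)=\frac{S_{x+y}(\zeta)}{\Delta_{x+y}}\,\Gamma_{\mathbb{R}^2}(x,y,z).$$ Here $S_{x+y}(\zeta)$ and $\Delta_{x+y}$ are the values of the closure of $f_{x+y}$ once around the annulus and in the plane, respectively. -/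

import Mathlib

namespace ThetaNet

open Polynomial

noncomputable section

/-! ### The coefficient field and the quantum integers -/

/-- The field `ℚ(A)` of rational functions in one variable. -/
abbrev K : Type := RatFunc ℚ

/-- The Kauffman variable. -/
def A : K := RatFunc.X

/-- The value of a homotopically trivial circle, `d = -A² - A⁻²`. -/
def d : K := -A ^ 2 - (A ^ 2)⁻¹

/-- `Δₙ = (-1)ⁿ (A^(2n+2) - A^(-2n-2)) / (A² - A⁻²)`. -/
def Delta (n : ℕ) : K :=
  (-1) ^ n * (A ^ (2 * n + 2) - (A ^ (2 * n + 2))⁻¹) / (A ^ 2 - (A ^ 2)⁻¹)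

/-- `({n}_q)! = {1}_q ⋯ {n}_q` with `{m}_q = 1 + q + ⋯ + q^(m-1)` and `q = A⁴`. -/
def quantumFactorial (n : ℕ) : K :=
  ∏ m ∈ Finset.range n, ∑ k ∈ Finset.range (m + 1), (A ^ 4) ^ k

/-! ### Crossingless diagrams -/

/-- A horizontal slice of a crossingless diagram, between a top line and a bottom line, on which
the end points are numbered `0, 1, 2, …` from left to right.
`cap i` joins the top points `i` and `i + 1` to each other;
`cup i` joins the bottom points `i` and `i + 1` to each other.
In both cases the other points are joined by vertical strands, in order. -/
inductive Slice : Type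
  | cap (i : ℕ)
  | cup (i : ℕ)

/-- The number of points on the bottom line of a slice with `m` points on its top line. -/
def Slice.below (m : ℕ) : Slice → ℕ
  | .cap _ => m - 2
  | .cup _ => m + 2

/-- The arcs of a slice. A point is a pair `(ℓ, i)` of a line `ℓ` (`0` for the top line, `1` for the
bottom line) and a position `i` on that line. -/
inductive Slice.Joins : Slice → ℕ × ℕ → ℕ × ℕ → Prop
  | cap_turn (i : ℕ) : Joins (.cap i) (0, i) (0, i + 1)
  | cap_left (i j : ℕ) (h : j < i) : Joins (.cap i) (0, j) (1, j)
  | cap_right (i j : ℕ) (h : i ≤ j) : Joins (.cap i) (0, j + 2) (1, j)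
  | cup_turn (i : ℕ) : Joins (.cup i) (1, i) (1, i + 1)
  | cup_left (i j : ℕ) (h : j < i) : Joins (.cup i) (0, j) (1, j)
  | cup_right (i j : ℕ) (h : i ≤ j) : Joins (.cup i) (0, j) (1, j + 2)

/-- The number of points on the lowest line of the diagram obtained by stacking the slices of `w`
from top to bottom, when there are `n` points on the highest line. -/
def width (n : ℕ) (w : List Slice) : ℕ := w.foldl Slice.below n

/-- The points of the stack `w` with `n` points at the top: `(t, j)` is the point in position `j`
on the line just above slice number `t` (the lowest line for `t = w.length`). -/
def Node (n : ℕ) (w : List Slice) : Type :=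
  {q : ℕ × ℕ // q.1 ≤ w.length ∧ q.2 < width n (w.take q.1)}

/-- The arcs of the closure of the stack `w`, in which each point of the lowest line is joined to
the point of the highest line in the same position, by parallel arcs going once around the annulus.
The integer records how often the arc crosses the radial cut between the lowest and the highest
line; the arc is oriented from its first point to its second. -/
inductive Arc (w : List Slice) : ℤ → ℕ × ℕ → ℕ × ℕ → Prop
  | slice (t : ℕ) (p : Slice) (s i r j : ℕ) (hp : w[t]? = some p) (h : p.Joins (s, i) (r, j)) :
      Arc w 0 (t + s, i) (t + r, j)
  | close (i : ℕ) : Arc w 1 (w.length, i) (0, i)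

/-- The circles of the closure of a stack `w` with `n` points on its highest and on its lowest line:
the connected components of the union of all arcs. -/
def Circle (n : ℕ) (w : List Slice) : Type :=
  Quot fun u v : Node n w => ∃ ε : ℤ, Arc w ε u.1 v.1

/-- The arcs of the preimage of the closed diagram in the universal cover of the annulus, whose
points are the pairs of a sheet and a point of the diagram. -/
def CoverArc (n : ℕ) (w : List Slice) (a b : ℤ × Node n w) : Prop :=
  Arc w (b.1 - a.1) a.2.1 b.2.1

/-- A circle is homotopically non-trivial in the annulus when it does not lift to a closed curve in
the universal cover: some point over it is connected to a different point of the same fibre. -/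
def Circle.Essential {n : ℕ} {w : List Slice} (C : Circle n w) : Prop :=
  ∃ u : Node n w, Quot.mk _ u = C ∧
    ∃ k : ℤ, k ≠ 0 ∧ Relation.EqvGen (CoverArc n w) (0, u) (k, u)

/-- The bracket `dᵏ zᵐ ∈ ℚ(A)[z]` of the closure in the annulus of a stack, where `k` and `m` are
the numbers of homotopically trivial and of homotopically non-trivial circles. -/
def annularBracket (n : ℕ) (w : List Slice) : K[X] :=
  C (d ^ Nat.card {c : Circle n w // ¬ c.Essential}) * X ^ Nat.card {c : Circle n w // c.Essential}

/-- The bracket of the closure in the plane, where all circles are trivial. -/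
def planarBracket (n : ℕ) (w : List Slice) : K := d ^ Nat.card (Circle n w)

/-- Formal linear combinations of stacks of slices, over `ℚ(A)`; the product is stacking, the left
factor on top. -/
abbrev Tangles : Type := MonoidAlgebra K (FreeMonoid Slice)

/-- A single stack of slices as a formal linear combination. -/
def diagram (w : List Slice) : Tangles := MonoidAlgebra.of K (FreeMonoid Slice) (FreeMonoid.ofList w)

/-- The trace in the annulus: the linear extension of the bracket of the annular closure. It is
meant for combinations of stacks with `n` points on both their highest and their lowest line. -/
def annularTrace (n : ℕ) (f : Tangles) : K[X] :=
  f.coeff.sum fun w r => r • annularBracket n w.toList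

/-- The trace in the plane: the linear extension of the bracket of the planar closure. -/
def planarTrace (n : ℕ) (f : Tangles) : K :=
  f.coeff.sum fun w r => r • planarBracket n w.toList

/-! ### The Jones-Wenzl idempotents -/

/-- The Temperley-Lieb generator that joins the top points `i, i + 1` and the bottom points
`i, i + 1`. -/
def e (i : ℕ) : Tangles := diagram [.cap i, .cup i]

/-- The Kauffman bracket expansion of the positive crossing of the strands `i` and `i + 1`. -/
def sigma (i : ℕ) : Tangles := A • (1 : Tangles) + A⁻¹ • e i

/-- The number of `i < j` whose order relative to `j` is reversed by `π⁻¹`. -/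
def lehmer {n : ℕ} (π : Equiv.Perm (Fin n)) (j : Fin n) : ℕ :=
  (Finset.univ.filter fun i : Fin n => i < j ∧ π⁻¹ j < π⁻¹ i).card

/-- A reduced word for `π` in the adjacent transpositions `(i, i + 1)`: the concatenation over
`j = 0, …, n - 1` of the words `j - 1, j - 2, …, j - lehmer π j`. -/
def permWord {n : ℕ} (π : Equiv.Perm (Fin n)) : List ℕ :=
  (List.finRange n).flatMap fun j => (List.range (lehmer π j)).map fun k => (j : ℕ) - 1 - k

/-- The bracket expansion of the minimal positive braid with permutation `π`, drawn on the
strands `s, …, s + n - 1`. -/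
def permBraid (s : ℕ) {n : ℕ} (π : Equiv.Perm (Fin n)) : Tangles :=
  ((permWord π).map fun i => sigma (s + i)).prod

/-- The Jones-Wenzl idempotent `fₙ = (1 / ({n}_{A⁴})!) ∑_π (A³)^|π| b_π`, drawn on the strands
`s, …, s + n - 1`. -/
def jonesWenzl (s n : ℕ) : Tangles :=
  (quantumFactorial n)⁻¹ •
    ∑ π : Equiv.Perm (Fin n), (A ^ 3) ^ (permWord π).length • permBraid s π

/-! ### The decorated theta curve -/

/-- `z` nested cups inserted after the first `y` strands. -/
def nestedCups (y z : ℕ) : Tangles := diagram ((List.range z).map fun k => .cup (y + k))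

/-- `z` nested caps closing off the `2 z` strands after the first `y` strands. -/
def nestedCaps (y z : ℕ) : Tangles :=
  diagram ((List.range z).reverse.map fun k => .cap (y + k))

/-- The decorated theta curve cut open along its edge `c`, with `x + y` points at the top and at the
bottom. The edges carry `a = y + z`, `b = x + z` and `c = x + y` parallel strands and the idempotents
`f_a`, `f_b` and `f_c`. At each of the two vertices `y` strands run between `c` and `a` (on the left),
`x` strands between `c` and `b` (on the right), and `z` strands between `a` and `b`. -/
def openTheta (x y z : ℕ) : Tangles :=
  jonesWenzl 0 (x + y) * nestedCups y z * (jonesWenzl 0 (y + z) * jonesWenzl (y + z) (x + z)) *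
    nestedCaps y z

/-- The evaluation of the decorated theta curve in the plane. -/
def planarTheta (x y z : ℕ) : K := planarTrace (x + y) (openTheta x y z)

/-- The evaluation of the decorated theta curve in the annulus: of the three complementary regions
of the theta curve (seen on the sphere), the one between the edges `a` and `b` is filled by a disc
and the two that are adjacent to the edge `c` contain the two ends of the annulus, so that the
closure of the edge `c` goes once around the annulus. -/
def annularTheta (x y z : ℕ) : K[X] := annularTrace (x + y) (openTheta x y z)

end

/-! ### The words for permutations are reduced words -/

theorem lehmerBlock_apply (m c v : ℕ) (hc : c ≤ m) :
    (((List.range c).map fun k => m - 1 - k).map fun i => Equiv.swap i (i + 1)).prod v =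
      if v + c = m then m else if m < v + c ∧ v ≤ m then v - 1 else v := by
  induction c generalizing v with
  | zero => simp; grind
  | succ c ih =>
    rw [List.range_succ, List.map_append, List.map_append, List.prod_append, Equiv.Perm.mul_apply]
    simp only [List.map_cons, List.map_nil, List.prod_cons, List.prod_nil, mul_one]
    rw [ih _ (by omega), Equiv.swap_apply_def]
    grind

theorem prod_permWord_aux {n : ℕ} (π : Equiv.Perm (Fin n)) (m : ℕ) (hm : m ≤ n) :
    (∀ v, m ≤ v → (((List.finRange n).take m).map fun j : Fin n =>
      (((List.range (lehmer π j)).map fun k => (j : ℕ) - 1 - k).map fun i =>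
        Equiv.swap i (i + 1)).prod).prod v = v) ∧
    ∀ i : Fin n, (i : ℕ) < m → (((List.finRange n).take m).map fun j : Fin n =>
      (((List.range (lehmer π j)).map fun k => (j : ℕ) - 1 - k).map fun i =>
        Equiv.swap i (i + 1)).prod).prod
      (Finset.univ.filter fun l : Fin n => (l : ℕ) < m ∧ π⁻¹ l < π⁻¹ i).card = i := by
  induction m with
  | zero => simp
  | succ m ih =>
    obtain ⟨ih1, ih2⟩ := ih (by omega)
    have hmn : m < n := by omega
    set M : Fin n := ⟨m, hmn⟩ with hM
    have hcard : (Finset.univ.filter fun l : Fin n => (l : ℕ) < m).card = m := by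
      have : (Finset.univ.filter fun l : Fin n => (l : ℕ) < m) = Finset.Iio M := by
        ext l; simp [hM, Fin.lt_def]
      rw [this]; simp [hM]
    have hsplit : (Finset.univ.filter fun l : Fin n => (l : ℕ) < m ∧ π⁻¹ l < π⁻¹ M).card +
        lehmer π M = m := by
      conv_rhs => rw [← hcard]
      rw [lehmer, ← Finset.card_union_of_disjoint]
      · congr 1
        ext l
        simp only [Finset.mem_union, Finset.mem_filter, Finset.mem_univ, true_and, Fin.lt_def, hM]
        constructor
        · rintro (h | h) <;> exact h.1
        · intro h
          have hne : (π⁻¹ l : Fin n) ≠ π⁻¹ M := by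
            intro h'
            have := (π⁻¹).injective h'
            rw [this] at h
            simp [hM] at h
          have hne' : ((π⁻¹ l : Fin n) : ℕ) ≠ (π⁻¹ M : Fin n) := fun h' => hne (Fin.ext h')
          simp only [hM] at hne'
          omega
      · rw [Finset.disjoint_left]
        intro l h1 h2
        simp only [Finset.mem_filter, Finset.mem_univ, true_and] at h1 h2
        exact absurd h1.2 (not_lt_of_gt h2.2)
    have htake : (List.finRange n).take (m + 1) = (List.finRange n).take m ++ [M] := by
      rw [List.take_succ_eq_append_getElem (by simpa using hmn)]
      simp [hM]
    have hstep : ∀ v, (((List.finRange n).take (m + 1)).map fun j : Fin n =>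
        (((List.range (lehmer π j)).map fun k => (j : ℕ) - 1 - k).map fun i =>
          Equiv.swap i (i + 1)).prod).prod v = (((List.finRange n).take m).map fun j : Fin n =>
        (((List.range (lehmer π j)).map fun k => (j : ℕ) - 1 - k).map fun i =>
          Equiv.swap i (i + 1)).prod).prod
        (if v + lehmer π M = m then m else if m < v + lehmer π M ∧ v ≤ m then v - 1 else v) := by
      intro v
      rw [htake, List.map_append, List.prod_append, Equiv.Perm.mul_apply]
      simp only [List.map_cons, List.map_nil, List.prod_cons, List.prod_nil, mul_one]
      rw [lehmerBlock_apply _ _ _ (show lehmer π M ≤ m by omega)]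
    constructor
    · intro v hv
      rw [hstep, if_neg (by omega), if_neg (by omega)]
      exact ih1 v (by omega)
    · intro i hi
      rw [hstep]
      by_cases him : (i : ℕ) = m
      · have hiM : i = M := Fin.ext him
        have hsame : (Finset.univ.filter fun l : Fin n => (l : ℕ) < m + 1 ∧ π⁻¹ l < π⁻¹ i) =
            Finset.univ.filter fun l : Fin n => (l : ℕ) < m ∧ π⁻¹ l < π⁻¹ M := by
          ext l
          simp only [Finset.mem_filter, Finset.mem_univ, true_and, hiM]
          constructor
          · rintro ⟨h1, h2⟩
            refine ⟨?_, h2⟩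
            rcases Nat.lt_succ_iff_lt_or_eq.1 h1 with h | h
            · exact h
            · rw [show l = M from Fin.ext h] at h2
              exact absurd h2 (lt_irrefl _)
          · rintro ⟨h1, h2⟩
            exact ⟨by omega, h2⟩
        rw [hsame, if_pos hsplit, ih1 m le_rfl, him]
      · have him' : (i : ℕ) < m := by omega
        rcases lt_or_ge (π⁻¹ M) (π⁻¹ i) with h | h
        · have hins : (Finset.univ.filter fun l : Fin n => (l : ℕ) < m + 1 ∧ π⁻¹ l < π⁻¹ i) =
              insert M (Finset.univ.filter fun l : Fin n => (l : ℕ) < m ∧ π⁻¹ l < π⁻¹ i) := by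
            ext l
            simp only [Finset.mem_filter, Finset.mem_univ, true_and, Finset.mem_insert]
            constructor
            · rintro ⟨h1, h2⟩
              rcases Nat.lt_succ_iff_lt_or_eq.1 h1 with h' | h'
              · exact Or.inr ⟨h', h2⟩
              · exact Or.inl (Fin.ext h')
            · rintro (rfl | ⟨h1, h2⟩)
              · exact ⟨by simp [hM], h⟩
              · exact ⟨by omega, h2⟩
          have hge : (Finset.univ.filter fun l : Fin n => (l : ℕ) < m ∧ π⁻¹ l < π⁻¹ M).card ≤
              (Finset.univ.filter fun l : Fin n => (l : ℕ) < m ∧ π⁻¹ l < π⁻¹ i).card := by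
            apply Finset.card_le_card
            intro l
            simp only [Finset.mem_filter, Finset.mem_univ, true_and]
            exact fun h' => ⟨h'.1, h'.2.trans h⟩
          have hle : (Finset.univ.filter fun l : Fin n => (l : ℕ) < m ∧ π⁻¹ l < π⁻¹ i).card ≤
              m - 1 := by
            have hsub : (Finset.univ.filter fun l : Fin n => (l : ℕ) < m ∧ π⁻¹ l < π⁻¹ i).card <
                (Finset.univ.filter fun l : Fin n => (l : ℕ) < m).card := by
              apply Finset.card_lt_card
              rw [Finset.ssubset_iff_of_subset (fun l => by
                simp only [Finset.mem_filter, Finset.mem_univ, true_and]; exact fun h' => h'.1)]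
              exact ⟨i, by simpa using him', by simp⟩
            omega
          rw [hins, Finset.card_insert_of_notMem (by simp [hM]), if_neg (by omega),
            if_pos (by omega), Nat.add_sub_cancel]
          exact ih2 i him'
        · have hne : (π⁻¹ i : Fin n) ≠ π⁻¹ M := by
            intro h'
            rw [(π⁻¹).injective h'] at him
            exact him rfl
          have h' : π⁻¹ i < π⁻¹ M := lt_of_le_of_ne h hne
          have hsame : (Finset.univ.filter fun l : Fin n => (l : ℕ) < m + 1 ∧ π⁻¹ l < π⁻¹ i) =
              Finset.univ.filter fun l : Fin n => (l : ℕ) < m ∧ π⁻¹ l < π⁻¹ i := by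
            ext l
            simp only [Finset.mem_filter, Finset.mem_univ, true_and]
            constructor
            · rintro ⟨h1, h2⟩
              refine ⟨?_, h2⟩
              rcases Nat.lt_succ_iff_lt_or_eq.1 h1 with h3 | h3
              · exact h3
              · rw [show l = M from Fin.ext h3] at h2
                exact absurd h2 (not_lt_of_gt h')
            · rintro ⟨h1, h2⟩
              exact ⟨by omega, h2⟩
          have hlt : (Finset.univ.filter fun l : Fin n => (l : ℕ) < m ∧ π⁻¹ l < π⁻¹ i).card <
              (Finset.univ.filter fun l : Fin n => (l : ℕ) < m ∧ π⁻¹ l < π⁻¹ M).card := by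
            apply Finset.card_lt_card
            rw [Finset.ssubset_iff_of_subset (fun l => by
              simp only [Finset.mem_filter, Finset.mem_univ, true_and]
              exact fun h3 => ⟨h3.1, h3.2.trans h'⟩)]
            refine ⟨i, ?_, by simp⟩
            simp only [Finset.mem_filter, Finset.mem_univ, true_and]
            exact ⟨him', h'⟩
          rw [hsame, if_neg (by omega), if_neg (by omega)]
          exact ih2 i him'

/-- The product of the adjacent transpositions in `permWord π` is `π`. -/
theorem prod_permWord {n : ℕ} (π : Equiv.Perm (Fin n)) (j : Fin n) :
    ((permWord π).map fun i => Equiv.swap i (i + 1)).prod (j : ℕ) = π j := by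
  have h := (prod_permWord_aux π n le_rfl).2 (π j) (π j).2
  have hc : (Finset.univ.filter fun l : Fin n => (l : ℕ) < n ∧ π⁻¹ l < π⁻¹ (π j)).card = j := by
    have : (Finset.univ.filter fun l : Fin n => (l : ℕ) < n ∧ π⁻¹ l < π⁻¹ (π j)) =
        (Finset.Iio j).map π.toEmbedding := by
      ext l
      simp [Finset.mem_map_equiv]
    rw [this, Finset.card_map, Fin.card_Iio]
  rw [hc, List.take_of_length_le (by simp)] at h
  rw [permWord, List.map_flatMap, List.flatMap_def, List.prod_flatten, List.map_map]
  exact h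

/-- The length of `permWord π` is the number of inversions of `π`. -/
theorem length_permWord {n : ℕ} (π : Equiv.Perm (Fin n)) :
    (permWord π).length =
      (Finset.univ.filter fun p : Fin n × Fin n => p.1 < p.2 ∧ π p.2 < π p.1).card := by
  have h1 : (permWord π).length = ∑ j : Fin n, lehmer π j := by
    rw [permWord, List.length_flatMap, ← List.sum_ofFn, List.ofFn_eq_map]
    simp
  have h2 : (Finset.univ.filter fun p : Fin n × Fin n => p.1 < p.2 ∧ π p.2 < π p.1).card =
      (Finset.univ.filter fun p : Fin n × Fin n => p.1 < p.2 ∧ π⁻¹ p.2 < π⁻¹ p.1).card := by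
    refine Finset.card_bij' (fun p _ => (π p.2, π p.1)) (fun p _ => (π⁻¹ p.2, π⁻¹ p.1))
      ?_ ?_ ?_ ?_ <;> simp +contextual
  rw [h1, h2, Finset.card_filter, ← Finset.univ_product_univ, Finset.sum_product_right]
  refine Finset.sum_congr rfl fun j _ => ?_
  rw [lehmer, Finset.card_filter]

end ThetaNet

/-!
The functions on the points of a closed stack that are constant along its arcs, up to a factor `c`
for each turn around the annulus, form a space whose dimension is the number of circles around which
this factor is trivial: all circles for `c = 1`, and the homotopically trivial ones for `c = 2`.
Solving the equations of a few slices therefore shows that the bracket satisfies the skein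
relations, and moving the closing arcs shows that it is a trace.

Modulo the skein relations every closed diagram on `n` strands is a multiple of the identity or of a
diagram that starts with a cap, and `fₙ` annihilates the latter. So the theta graph, cut open along
its edge `c`, is a multiple of `f_{x+y}`. Its value is the same multiple of the closure of
`f_{x+y}`, which satisfies the recursion of the Chebyshev polynomials because of the factorization
of `fₙ₊₁` along the cosets of `𝔖ₙ` in `𝔖ₙ₊₁`. The planar evaluation is the annular one at `ζ = d`,
and it determines the multiple.
-/

namespace ThetaNet

open Polynomial Relation

section FlatFunctions

variable {α 𝕜 : Type*} [Field 𝕜] (r : ℤ → α → α → Prop) (c : 𝕜ˣ)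

/-- The relation `r ε a b` says that an arc of winding number `ε` leads from `a` to `b`; this is the
adjacency relation of the corresponding infinite cyclic cover. -/
def Cover (x y : ℤ × α) : Prop := r (y.1 - x.1) x.2 y.2

/-- The functions that are multiplied by `c ^ ε` along each arc of winding number `ε`: the flat
sections of the line bundle with holonomy `c`. -/
def flatFunctions : Submodule 𝕜 (α → 𝕜) where
  carrier := {f | ∀ ε a b, r ε a b → f b = (c ^ ε : 𝕜ˣ) * f a}
  add_mem' hf hg ε a b h := by simp only [Pi.add_apply, hf ε a b h, hg ε a b h, mul_add]
  zero_mem' ε a b _ := by simp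
  smul_mem' s f hf ε a b h := by
    simp only [Pi.smul_apply, smul_eq_mul, hf ε a b h, mul_left_comm]

/-- The connected components around which the line bundle with holonomy `c` is trivial. -/
def IsBalanced (C : Quot fun a b => ∃ ε, r ε a b) : Prop :=
  ∀ a, Quot.mk _ a = C → ∀ k, EqvGen (Cover r) (0, a) (k, a) → c ^ k = 1

variable {r c}

theorem eqvGen_cover_add {x y : ℤ × α} (h : EqvGen (Cover r) x y) (k : ℤ) :
    EqvGen (Cover r) (x.1 + k, x.2) (y.1 + k, y.2) := by
  induction h with
  | rel x y h => exact .rel _ _ (by simpa only [Cover, add_sub_add_right_eq_sub] using h)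
  | refl x => exact .refl _
  | symm _ _ _ ih => exact ih.symm
  | trans _ _ _ _ _ ih ih' => exact ih.trans _ _ _ ih'

theorem exists_eqvGen_cover {a b : α} (h : EqvGen (fun a b => ∃ ε, r ε a b) a b) :
    ∃ k, EqvGen (Cover r) (0, a) (k, b) := by
  induction h with
  | rel a b h => exact h.imp fun ε h => .rel _ _ (by simpa only [Cover, sub_zero] using h)
  | refl a => exact ⟨0, .refl _⟩
  | symm a b _ ih =>
    obtain ⟨k, hk⟩ := ih
    exact ⟨-k, by simpa using (eqvGen_cover_add hk (-k)).symm⟩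
  | trans a b e _ _ ih ih' =>
    obtain ⟨k, hk⟩ := ih
    obtain ⟨l, hl⟩ := ih'
    exact ⟨l + k, hk.trans _ _ _ (by simpa using eqvGen_cover_add hl k)⟩

theorem exists_eqvGen_cover_out (a : α) :
    ∃ k, EqvGen (Cover r) (0, (Quot.mk (fun a b => ∃ ε, r ε a b) a).out) (k, a) :=
  exists_eqvGen_cover (Quot.eqvGen_exact (Quot.out_eq _))

theorem apply_eq_of_mem_flatFunctions {f : α → 𝕜} (hf : f ∈ flatFunctions r c) {x y : ℤ × α}
    (h : EqvGen (Cover r) x y) : f y.2 = (c ^ (y.1 - x.1) : 𝕜ˣ) * f x.2 := by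
  induction h with
  | rel x y h => exact hf _ _ _ h
  | refl x => simp
  | symm x y _ ih => rw [ih, ← mul_assoc, ← Units.val_mul, ← zpow_add]; simp
  | trans x y z _ _ ih ih' =>
    rw [ih', ih, ← mul_assoc, ← Units.val_mul, ← zpow_add, sub_add_sub_cancel]

theorem apply_eq_zero_of_not_isBalanced {f : α → 𝕜} (hf : f ∈ flatFunctions r c) {a : α}
    (h : ¬ IsBalanced r c (Quot.mk _ a)) : f a = 0 := by
  simp only [IsBalanced, not_forall] at h
  obtain ⟨b, hba, k, hk, hck⟩ := h
  have hloop : (c ^ k : 𝕜ˣ) * f b = f b := by simpa using (apply_eq_of_mem_flatFunctions hf hk).symm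
  have hb : f b = 0 := (mul_left_eq_self₀.1 hloop).resolve_left fun h => hck (Units.ext h)
  obtain ⟨l, hl⟩ := exists_eqvGen_cover (Quot.eqvGen_exact hba)
  rw [apply_eq_of_mem_flatFunctions hf hl, hb, mul_zero]

theorem IsBalanced.zpow_eq_zpow {a b : α} (h : IsBalanced r c (Quot.mk _ a)) {k l : ℤ}
    (hk : EqvGen (Cover r) (0, a) (k, b)) (hl : EqvGen (Cover r) (0, a) (l, b)) :
    c ^ k = c ^ l := by
  have hback : EqvGen (Cover r) (k, b) (k - l, a) := by
    simpa using (eqvGen_cover_add hl (k - l)).symm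
  rw [← mul_inv_eq_one, ← zpow_sub]
  exact h a rfl _ (hk.trans _ _ _ hback)

theorem exists_flatFunction_apply_out (g : {C // IsBalanced r c C} → 𝕜) :
    ∃ f ∈ flatFunctions r c, ∀ C, f C.1.out = g C := by
  classical
  choose φ hφ using exists_eqvGen_cover_out (r := r)
  refine ⟨fun a => if h : IsBalanced r c (Quot.mk _ a) then (c ^ φ a : 𝕜ˣ) * g ⟨_, h⟩ else 0,
    fun ε a b h => ?_, fun C => ?_⟩
  · have hab : Quot.mk (fun a b => ∃ ε, r ε a b) a = Quot.mk _ b := Quot.sound ⟨ε, h⟩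
    simp only [hab]
    split_ifs with hC
    · have hstep : EqvGen (Cover r) (φ a, a) (ε + φ a, b) := .rel _ _ (by simpa [Cover] using h)
      have hpath := hab ▸ (hφ a).trans _ _ _ hstep
      rw [IsBalanced.zpow_eq_zpow (by rwa [Quot.out_eq]) (hφ b) hpath, zpow_add, Units.val_mul,
        mul_assoc]
    · rw [mul_zero]
  · have hout : c ^ φ C.1.out = 1 := by
      simpa using IsBalanced.zpow_eq_zpow (r := r) (by simpa only [Quot.out_eq] using C.2)
        (by simpa only [Quot.out_eq] using hφ C.1.out) (EqvGen.refl (0, C.1.out))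
    simp [hout, C.2]

/-- Evaluation at base points identifies the flat functions with the functions on the balanced
components. -/
theorem finrank_flatFunctions [Finite α] :
    Module.finrank 𝕜 (flatFunctions r c) = Nat.card {C // IsBalanced r c C} := by
  have : Finite (Quot fun a b => ∃ ε, r ε a b) := inferInstance
  let ev : flatFunctions r c →ₗ[𝕜] {C // IsBalanced r c C} → 𝕜 :=
    (LinearMap.funLeft 𝕜 𝕜 fun C : {C // IsBalanced r c C} => C.1.out) ∘ₗ
      (flatFunctions r c).subtype
  have hinj : Function.Injective ev := by
    rw [injective_iff_map_eq_zero]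
    intro f hf
    ext a
    by_cases h : IsBalanced r c (Quot.mk _ a)
    · obtain ⟨k, hk⟩ := exists_eqvGen_cover_out (r := r) a
      have hout : f.1 _ = 0 := congrFun hf ⟨_, h⟩
      rw [apply_eq_of_mem_flatFunctions f.2 hk, hout, mul_zero]; rfl
    · exact apply_eq_zero_of_not_isBalanced f.2 h
  have hsurj : Function.Surjective ev := fun g =>
    let ⟨f, hf, hfg⟩ := exists_flatFunction_apply_out g
    ⟨⟨f, hf⟩, funext hfg⟩
  have := Fintype.ofFinite {C // IsBalanced r c C}
  rw [(LinearEquiv.ofBijective ev ⟨hinj, hsurj⟩).finrank_eq, Module.finrank_fintype_fun_eq_card,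
    Nat.card_eq_fintype_card]

end FlatFunctions

section Sections

variable {𝕜 : Type*} [Field 𝕜]

/-- The position on the wider line of a slice that turns back at `i`, `i + 1` of the point `k` of
the narrower line. -/
def insertTwo (i k : ℕ) : ℕ := if k < i then k else k + 2

/-- The functions `q` on a line of `m` points and `r` on a line of `m - 2` points agree along the
arcs of a slice that joins the points `i`, `i + 1` of the wider line to each other. -/
def AgreeAcross (m i : ℕ) (q r : ℕ → 𝕜) : Prop :=
  (i + 1 < m → q i = q (i + 1)) ∧ ∀ k < m - 2, r k = q (insertTwo i k)

/-- The functions `q` on the `m` top points and `r` on the bottom points of a slice agree along its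
arcs. -/
def Slice.Agree (m : ℕ) : Slice → (ℕ → 𝕜) → (ℕ → 𝕜) → Prop
  | .cap i, q, r => AgreeAcross m i q r
  | .cup i, q, r => AgreeAcross (m + 2) i r q

/-- The pair `q` of a line and a position is a point of the stack `w` with `n` points at the top. -/
def IsPoint (n : ℕ) (w : List Slice) (q : ℕ × ℕ) : Prop :=
  q.1 ≤ w.length ∧ q.2 < width n (w.take q.1)

variable (𝕜) in
/-- The functions on the points of the stack `w` that are constant along the arcs of its slices,
extended by zero to all pairs of a line and a position. -/
def stackSections (n : ℕ) (w : List Slice) : Submodule 𝕜 (ℕ → ℕ → 𝕜) where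
  carrier := {f | (∀ t j, ¬ IsPoint n w (t, j) → f t j = 0) ∧
    ∀ a b, IsPoint n w a → IsPoint n w b → Arc w 0 a b → f b.1 b.2 = f a.1 a.2}
  add_mem' hf hg := ⟨fun t j h => by simp [hf.1 t j h, hg.1 t j h],
    fun a b ha hb h => by simp [hf.2 a b ha hb h, hg.2 a b ha hb h]⟩
  zero_mem' := ⟨fun _ _ _ => rfl, fun _ _ _ _ _ => rfl⟩
  smul_mem' x f hf := ⟨fun t j h => by simp [hf.1 t j h],
    fun a b ha hb h => by simp [hf.2 a b ha hb h]⟩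

/-- The functions on the points of the closure of the stack `w` that are constant along the arcs of
the slices and multiplied by `c` along the closing arcs. -/
def closedSections (c : 𝕜ˣ) (n : ℕ) (w : List Slice) : Submodule 𝕜 (ℕ → ℕ → 𝕜) where
  carrier := {f | f ∈ stackSections 𝕜 n w ∧
    ∀ j, j < n → j < width n w → f 0 j = c * f w.length j}
  add_mem' hf hg := ⟨add_mem hf.1 hg.1, fun j h h' => by
    simp only [Pi.add_apply, hf.2 j h h', hg.2 j h h', mul_add]⟩
  zero_mem' := ⟨zero_mem _, fun j _ _ => by simp⟩
  smul_mem' a f hf := ⟨Submodule.smul_mem _ a hf.1, fun j h h' => by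
    simp only [Pi.smul_apply, smul_eq_mul, hf.2 j h h', mul_left_comm]⟩

variable {c : 𝕜ˣ} {m n : ℕ} {w : List Slice}

theorem width_take_succ {t : ℕ} {s : Slice} (h : w[t]? = some s) :
    width n (w.take (t + 1)) = s.below (width n (w.take t)) := by
  simp [width, List.take_add_one, h]

omit [Field 𝕜] in
theorem Slice.agree_iff {s : Slice} {f : ℕ → ℕ → 𝕜} {t : ℕ} :
    s.Agree m (f t) (f (t + 1)) ↔ ∀ l i l' j, s.Joins (l, i) (l', j) →
      i < (if l = 0 then m else s.below m) → j < (if l' = 0 then m else s.below m) →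
      f (t + l') j = f (t + l) i := by
  constructor
  · intro h l i l' j hJ
    cases hJ <;> simp only [Slice.Agree, AgreeAcross, insertTwo, Slice.below] at * <;> grind
  · intro h
    cases s with
    | cap i =>
      refine ⟨fun hi => ?_, fun k hk => ?_⟩
      · exact (h _ _ _ _ (.cap_turn i) (by grind) (by grind)).symm
      · unfold insertTwo
        split_ifs with hki
        · exact h _ _ _ _ (.cap_left i k hki) (by grind) (by grind [Slice.below])
        · exact h _ _ _ _ (.cap_right i k (by omega)) (by grind) (by grind [Slice.below])
    | cup i =>
      refine ⟨fun hi => ?_, fun k hk => ?_⟩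
      · exact (h _ _ _ _ (.cup_turn i) (by grind [Slice.below]) (by grind [Slice.below])).symm
      · unfold insertTwo
        split_ifs with hki
        · exact (h _ _ _ _ (.cup_left i k hki) (by grind) (by grind [Slice.below])).symm
        · exact (h _ _ _ _ (.cup_right i k (by omega)) (by grind) (by grind [Slice.below])).symm

theorem Slice.Joins.line_le_one {s : Slice} {l i l' j : ℕ} (h : s.Joins (l, i) (l', j)) :
    l ≤ 1 ∧ l' ≤ 1 := by
  cases h <;> simp

theorem isPoint_line_add_iff {t l i : ℕ} {s : Slice} (h : w[t]? = some s) (hl : l ≤ 1) :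
    IsPoint n w (t + l, i) ↔
      i < if l = 0 then width n (w.take t) else s.below (width n (w.take t)) := by
  obtain ⟨ht, -⟩ := List.getElem?_eq_some_iff.1 h
  interval_cases l <;> simp [IsPoint, width_take_succ h] <;> omega

theorem mem_stackSections_iff {f : ℕ → ℕ → 𝕜} :
    f ∈ stackSections 𝕜 n w ↔ (∀ t j, ¬ IsPoint n w (t, j) → f t j = 0) ∧
      ∀ (t : ℕ) (s : Slice), w[t]? = some s → s.Agree (width n (w.take t)) (f t) (f (t + 1)) := by
  refine and_congr_right fun _ => ⟨fun h t s hs => ?_, fun h a b ha hb harc => ?_⟩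
  · rw [Slice.agree_iff]
    intro l i l' j hJ hi hj
    rw [← isPoint_line_add_iff hs hJ.line_le_one.1] at hi
    rw [← isPoint_line_add_iff hs hJ.line_le_one.2] at hj
    exact h _ _ hi hj (.slice t s l i l' j hs hJ)
  · generalize hε : (0 : ℤ) = ε at harc
    cases harc with
    | slice t s l i l' j hs hJ =>
      exact Slice.agree_iff.1 (h t s hs) l i l' j hJ
        ((isPoint_line_add_iff hs hJ.line_le_one.1).1 ha)
        ((isPoint_line_add_iff hs hJ.line_le_one.2).1 hb)
    | close i => omega

/-- The arcs of the closure of `w`, as a relation on its points. -/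
def NodeArc (n : ℕ) (w : List Slice) (ε : ℤ) (u v : Node n w) : Prop := Arc w ε u.1 v.1

theorem isPoint_lowest_iff {j : ℕ} : IsPoint n w (w.length, j) ↔ j < width n w := by
  simp [IsPoint]

theorem isPoint_highest_iff {j : ℕ} : IsPoint n w (0, j) ↔ j < n := by
  simp [IsPoint, width]

theorem mem_closedSections_iff {f : ℕ → ℕ → 𝕜} :
    f ∈ closedSections c n w ↔ (∀ t j, ¬ IsPoint n w (t, j) → f t j = 0) ∧
      (fun u : Node n w => f u.1.1 u.1.2) ∈ flatFunctions (NodeArc n w) c := by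
  constructor
  · rintro ⟨⟨h0, h⟩, h'⟩
    refine ⟨h0, ?_⟩
    rintro ε ⟨a, ha⟩ ⟨b, hb⟩ (harc : Arc w ε a b)
    cases harc with
    | slice t s l i l' j hs hJ => simpa using h _ _ ha hb (.slice t s l i l' j hs hJ)
    | close i => simpa using h' i (isPoint_highest_iff.1 hb) (isPoint_lowest_iff.1 ha)
  · rintro ⟨h0, h⟩
    refine ⟨⟨h0, fun a b ha hb harc => ?_⟩, fun j hj hj' => ?_⟩
    · simpa using h 0 ⟨a, ha⟩ ⟨b, hb⟩ harc
    · simpa using h 1 ⟨_, isPoint_lowest_iff.2 hj'⟩ ⟨_, isPoint_highest_iff.2 hj⟩ (.close j)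

instance : Finite (Node n w) := by
  have : {q | IsPoint n w q}.Finite := by
    refine ((Set.finite_Iic w.length).biUnion fun t _ =>
      (Set.finite_Iio (width n (w.take t))).image (Prod.mk t)).subset ?_
    rintro ⟨t, j⟩ ⟨h1, h2⟩
    simp only [Set.mem_iUnion]
    exact ⟨t, h1, j, h2, rfl⟩
  exact this.to_subtype

variable (c n w) in
/-- Restriction to the points of the closure of `w`. -/
def restrictToNodes : closedSections c n w →ₗ[𝕜] flatFunctions (NodeArc n w) c where
  toFun f := ⟨fun u => f.1 u.1.1 u.1.2, (mem_closedSections_iff.1 f.2).2⟩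
  map_add' _ _ := rfl
  map_smul' _ _ := rfl

theorem restrictToNodes_bijective : Function.Bijective (restrictToNodes c n w) := by
  classical
  refine ⟨(injective_iff_map_eq_zero _).2 fun f hf => ?_, fun g => ?_⟩
  · ext t j
    by_cases h : IsPoint n w (t, j)
    · exact congrFun (congrArg Subtype.val hf) ⟨_, h⟩
    · exact (mem_closedSections_iff.1 f.2).1 t j h
  · let f t j := if h : IsPoint n w (t, j) then g.1 ⟨(t, j), h⟩ else 0
    have hfg : (fun u : Node n w => f u.1.1 u.1.2) = g := funext fun u => dif_pos u.2
    exact ⟨⟨f, mem_closedSections_iff.2 ⟨fun t j h => dif_neg h, hfg ▸ g.2⟩⟩, Subtype.ext hfg⟩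

instance : FiniteDimensional 𝕜 (closedSections c n w) :=
  .of_injective (restrictToNodes c n w) restrictToNodes_bijective.1

theorem finrank_closedSections :
    Module.finrank 𝕜 (closedSections c n w) =
      Nat.card {C : Circle n w // IsBalanced (NodeArc n w) c C} := by
  rw [(LinearEquiv.ofBijective _ restrictToNodes_bijective).finrank_eq, finrank_flatFunctions]
  rfl

end Sections

instance {n : ℕ} {w : List Slice} : Finite (Circle n w) := inferInstanceAs (Finite (Quot _))

theorem finrank_closedSections_one (n : ℕ) (w : List Slice) :
    Module.finrank ℚ (closedSections (1 : ℚˣ) n w) = Nat.card (Circle n w) := by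
  rw [finrank_closedSections]
  exact Nat.card_congr (Equiv.subtypeUnivEquiv fun C a _ k _ => one_zpow k)

theorem Circle.isBalanced_iff_not_essential {𝕜 : Type*} [Field 𝕜] {c : 𝕜ˣ}
    (hc : ∀ k : ℤ, c ^ k = 1 → k = 0)
    {n : ℕ} {w : List Slice} (C : Circle n w) :
    IsBalanced (NodeArc n w) c C ↔ ¬ C.Essential := by
  constructor
  · rintro h ⟨u, hu, k, hk, hloop⟩
    exact hk (hc k (h u hu k hloop))
  · intro h u hu k hloop
    by_contra hk
    exact h ⟨u, hu, k, fun h0 => hk (by rw [h0, zpow_zero]), hloop⟩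

theorem eq_zero_of_two_zpow_eq_one {k : ℤ} (h : (Units.mk0 2 two_ne_zero : ℚˣ) ^ k = 1) :
    k = 0 := by
  have h2 : (2 : ℚ) ^ k = 1 := by simpa using congrArg Units.val h
  exact (zpow_eq_one_iff_right₀ zero_le_two (by norm_num)).1 h2

theorem finrank_closedSections_two (n : ℕ) (w : List Slice) :
    Module.finrank ℚ (closedSections (Units.mk0 (2 : ℚ) two_ne_zero) n w) =
      Nat.card {C : Circle n w // ¬ C.Essential} := by
  rw [finrank_closedSections]
  exact Nat.card_congr (Equiv.subtypeEquivRight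
    (Circle.isBalanced_iff_not_essential fun _ => eq_zero_of_two_zpow_eq_one))

theorem card_not_essential_add_card_essential (n : ℕ) (w : List Slice) :
    Nat.card {C : Circle n w // ¬ C.Essential} + Nat.card {C : Circle n w // C.Essential} =
      Nat.card (Circle n w) := by
  classical
  rw [← Nat.card_sum, Nat.card_congr ((Equiv.sumComm _ _).trans (Equiv.sumCompl Circle.Essential))]

theorem eval_annularBracket (n : ℕ) (w : List Slice) :
    (annularBracket n w).eval d = planarBracket n w := by
  rw [annularBracket, planarBracket, eval_mul, eval_C, eval_pow, eval_X, ← pow_add,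
    card_not_essential_add_card_essential]

theorem annularBracket_eq_of_finrank {n n' k : ℕ} {w w' : List Slice}
    (h : ∀ c : ℚˣ, Module.finrank ℚ (closedSections c n w) =
      Module.finrank ℚ (closedSections c n' w') + k) :
    annularBracket n w = C (d ^ k) * annularBracket n' w' := by
  have hall := h 1
  have htrivial := h (Units.mk0 2 two_ne_zero)
  rw [finrank_closedSections_one, finrank_closedSections_one,
    ← card_not_essential_add_card_essential, ← card_not_essential_add_card_essential] at hall
  rw [finrank_closedSections_two, finrank_closedSections_two] at htrivial
  rw [annularBracket, annularBracket, htrivial, pow_add, C_mul,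
    show Nat.card {C : Circle n w // C.Essential} = Nat.card {C : Circle n' w' // C.Essential} by
      omega]
  ring

section Cut

variable {𝕜 : Type*} [Field 𝕜]

variable (𝕜) in
/-- Restriction of a function to the lines `0, …, l`, extended by zero. -/
def keepLines (l : ℕ) : (ℕ → ℕ → 𝕜) →ₗ[𝕜] ℕ → ℕ → 𝕜 where
  toFun f t := if t ≤ l then f t else 0
  map_add' f g := by ext t j; simp only [Pi.add_apply]; split_ifs <;> simp
  map_smul' a f := by ext t j; simp only [Pi.smul_apply]; split_ifs <;> simp

variable (𝕜) in
/-- Restriction of a function to the lines `l, l + 1, …`, renumbered from `0`. -/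
def dropLines (l : ℕ) : (ℕ → ℕ → 𝕜) →ₗ[𝕜] ℕ → ℕ → 𝕜 :=
  LinearMap.funLeft 𝕜 (ℕ → 𝕜) (l + ·)

/-- The function that is `g` on the lines `0, …, l` and `h` on the lines below them. -/
def glueLines (l : ℕ) (g h : ℕ → ℕ → 𝕜) : ℕ → ℕ → 𝕜 := fun t => if t ≤ l then g t else h (t - l)

theorem keepLines_apply {l t : ℕ} (f : ℕ → ℕ → 𝕜) (ht : t ≤ l) : keepLines 𝕜 l f t = f t :=
  if_pos ht

theorem keepLines_apply_of_lt {l t : ℕ} {f : ℕ → ℕ → 𝕜} (ht : l < t) : keepLines 𝕜 l f t = 0 :=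
  if_neg (by omega)

theorem dropLines_apply {l t : ℕ} {f : ℕ → ℕ → 𝕜} : dropLines 𝕜 l f t = f (l + t) := rfl

theorem dropLines_dropLines {l l' : ℕ} {f : ℕ → ℕ → 𝕜} :
    dropLines 𝕜 l' (dropLines 𝕜 l f) = dropLines 𝕜 (l + l') f := by
  ext t : 1; simp only [dropLines_apply, add_assoc]

variable {n : ℕ} {u v w : List Slice}

theorem width_append : width n (u ++ v) = width (width n u) v := List.foldl_append

theorem isPoint_append_of_le {t j : ℕ} (ht : t ≤ u.length) :
    IsPoint n (u ++ v) (t, j) ↔ IsPoint n u (t, j) := by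
  simp only [IsPoint, List.take_append_of_le_length ht, List.length_append]
  exact and_congr_left fun _ => by omega

theorem isPoint_append_add {t j : ℕ} :
    IsPoint n (u ++ v) (u.length + t, j) ↔ IsPoint (width n u) v (t, j) := by
  simp [IsPoint, List.take_length_add_append, width_append]

theorem mem_stackSections_append {f : ℕ → ℕ → 𝕜} :
    f ∈ stackSections 𝕜 n (u ++ v) ↔ keepLines 𝕜 u.length f ∈ stackSections 𝕜 n u ∧
      dropLines 𝕜 u.length f ∈ stackSections 𝕜 (width n u) v := by
  simp only [mem_stackSections_iff]
  constructor
  · rintro ⟨h0, h⟩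
    refine ⟨⟨fun t j ht => ?_, fun t s hs => ?_⟩, fun t j ht => ?_, fun t s hs => ?_⟩
    · by_cases htu : t ≤ u.length
      · rw [keepLines_apply f htu, h0 t j (by rwa [isPoint_append_of_le htu])]
      · rw [keepLines_apply_of_lt (by omega)]; rfl
    · obtain ⟨ht, -⟩ := List.getElem?_eq_some_iff.1 hs
      rw [keepLines_apply f ht.le, keepLines_apply f ht, ← List.take_append_of_le_length ht.le]
      exact h t s (by rwa [List.getElem?_append_left ht])
    · exact h0 _ _ (by rwa [isPoint_append_add])
    · simpa [List.take_length_add_append, width_append, dropLines_apply, add_assoc] using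
        h (u.length + t) s (by simpa [List.getElem?_append_right] using hs)
  · rintro ⟨⟨h0, h⟩, h0', h'⟩
    refine ⟨fun t j ht => ?_, fun t s hs => ?_⟩
    · rcases le_total t u.length with htu | htu
      · rw [← keepLines_apply f htu, h0 t j (by rwa [isPoint_append_of_le htu] at ht)]
      · obtain ⟨k, rfl⟩ := Nat.exists_eq_add_of_le htu
        exact h0' k j (by rwa [isPoint_append_add] at ht)
    · rcases lt_or_ge t u.length with htu | htu
      · rw [← keepLines_apply f htu, ← keepLines_apply f htu.le,
          List.take_append_of_le_length htu.le]
        exact h t s (by rwa [List.getElem?_append_left htu] at hs)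
      · obtain ⟨k, rfl⟩ := Nat.exists_eq_add_of_le htu
        simpa [List.take_length_add_append, width_append, dropLines_apply, add_assoc] using
          h' k s (by simpa [List.getElem?_append_right] using hs)

theorem keepLines_eq_self {g : ℕ → ℕ → 𝕜} (hg : g ∈ stackSections 𝕜 n u) :
    keepLines 𝕜 u.length g = g := by
  ext t j
  by_cases ht : t ≤ u.length
  · rw [keepLines_apply g ht]
  · rw [keepLines_apply_of_lt (by omega), hg.1 t j fun h => ht h.1]; rfl

theorem keepLines_glueLines {l : ℕ} {g h : ℕ → ℕ → 𝕜} :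
    keepLines 𝕜 l (glueLines l g h) = keepLines 𝕜 l g := by
  ext t : 1
  simp only [keepLines, glueLines, LinearMap.coe_mk, AddHom.coe_mk]
  split_ifs <;> rfl

theorem dropLines_glueLines {l : ℕ} {g h : ℕ → ℕ → 𝕜} (hgh : g l = h 0) :
    dropLines 𝕜 l (glueLines l g h) = h := by
  ext t : 1
  rw [dropLines_apply, glueLines]
  split_ifs with ht
  · obtain rfl : t = 0 := by omega
    exact hgh
  · rw [Nat.add_sub_cancel_left]

theorem glueLines_mem_stackSections {g h : ℕ → ℕ → 𝕜} (hg : g ∈ stackSections 𝕜 n u)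
    (hh : h ∈ stackSections 𝕜 (width n u) v) (hgh : g u.length = h 0) :
    glueLines u.length g h ∈ stackSections 𝕜 n (u ++ v) := by
  rw [mem_stackSections_append, keepLines_glueLines, keepLines_eq_self hg, dropLines_glueLines hgh]
  exact ⟨hg, hh⟩

/-- The functions `x` on the highest and `z` on the lowest line of the stack `w` are the boundary
values of a function that is constant along the arcs of `w`. -/
def IsBoundary (n : ℕ) (w : List Slice) (x z : ℕ → 𝕜) : Prop :=
  ∃ g ∈ stackSections 𝕜 n w, g 0 = x ∧ g w.length = z

variable (𝕜) in
/-- The functions that are constant along the arcs of the stack `w` and vanish on its boundary. -/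
def hiddenSections (n : ℕ) (w : List Slice) : Submodule 𝕜 (ℕ → ℕ → 𝕜) :=
  stackSections 𝕜 n w ⊓ LinearMap.ker (LinearMap.proj 0) ⊓
    LinearMap.ker (LinearMap.proj w.length)

variable (𝕜) in
/-- Restriction to the lines `0, …, l` and to the lines `l', l' + 1, …`. -/
def outerLines (l l' : ℕ) : (ℕ → ℕ → 𝕜) →ₗ[𝕜] (ℕ → ℕ → 𝕜) × (ℕ → ℕ → 𝕜) :=
  (keepLines 𝕜 l).prod (dropLines 𝕜 l')

variable {c : 𝕜ˣ} {p : List Slice}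

theorem glueLines_mem_closedSections {g x h : ℕ → ℕ → 𝕜} (hg : g ∈ stackSections 𝕜 n u)
    (hx : x ∈ stackSections 𝕜 (width n u) p) (hh : h ∈ stackSections 𝕜 (width n (u ++ p)) v)
    (hgx : g u.length = x 0) (hxh : x p.length = h 0)
    (hclose : ∀ j, j < n → j < width n (u ++ (p ++ v)) → g 0 j = c * h v.length j) :
    glueLines u.length g (glueLines p.length x h) ∈ closedSections c n (u ++ (p ++ v)) ∧
      outerLines 𝕜 u.length (u.length + p.length)
        (glueLines u.length g (glueLines p.length x h)) = (g, h) := by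
  have hxh' : glueLines p.length x h ∈ stackSections 𝕜 (width n u) (p ++ v) :=
    glueLines_mem_stackSections hx (by rwa [← width_append]) hxh
  have hglue : g u.length = glueLines p.length x h 0 := by simpa [glueLines] using hgx
  have hkeep : keepLines 𝕜 u.length (glueLines u.length g (glueLines p.length x h)) = g := by
    rw [keepLines_glueLines, keepLines_eq_self hg]
  have hdrop : dropLines 𝕜 (u.length + p.length)
      (glueLines u.length g (glueLines p.length x h)) = h := by
    rw [← dropLines_dropLines, dropLines_glueLines hglue, dropLines_glueLines hxh]
  refine ⟨⟨glueLines_mem_stackSections hg hxh' hglue, fun j hj hj' => ?_⟩, Prod.ext hkeep hdrop⟩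
  have htop := congrFun (congrFun hkeep 0) j
  have hbottom := congrFun (congrFun hdrop v.length) j
  rw [keepLines_apply _ (Nat.zero_le _)] at htop
  rw [dropLines_apply] at hbottom
  rw [List.length_append, List.length_append, ← add_assoc, htop, hbottom]
  exact hclose j hj hj'

theorem mem_map_outerLines_iff {a : (ℕ → ℕ → 𝕜) × (ℕ → ℕ → 𝕜)} :
    a ∈ (closedSections c n (u ++ (p ++ v))).map (outerLines 𝕜 u.length (u.length + p.length)) ↔
      a.1 ∈ stackSections 𝕜 n u ∧ a.2 ∈ stackSections 𝕜 (width n (u ++ p)) v ∧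
      IsBoundary (width n u) p (a.1 u.length) (a.2 0) ∧
      ∀ j, j < n → j < width n (u ++ (p ++ v)) → a.1 0 j = c * a.2 v.length j := by
  constructor
  · rintro ⟨f, ⟨hf, hclose⟩, rfl⟩
    obtain ⟨hu, hpv⟩ := mem_stackSections_append.1 hf
    obtain ⟨hp, hv⟩ := mem_stackSections_append.1 hpv
    rw [dropLines_dropLines, ← width_append] at hv
    refine ⟨hu, hv, ⟨_, hp, ?_, ?_⟩, fun j hj hj' => ?_⟩
    · simp [outerLines, keepLines_apply, dropLines_apply]
    · simp [outerLines, keepLines_apply, dropLines_apply]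
    · simpa [outerLines, keepLines_apply, dropLines_apply, add_assoc] using hclose j hj hj'
  · obtain ⟨g, h⟩ := a
    rintro ⟨hg, hh, ⟨x, hx, hgx, hxh⟩, hclose⟩
    obtain ⟨hmem, houter⟩ := glueLines_mem_closedSections hg hx hh hgx.symm hxh hclose
    exact ⟨_, hmem, houter⟩

variable (𝕜) in
/-- Shift of a function by `l` lines, extended by zero. -/
def padLines (l : ℕ) : (ℕ → ℕ → 𝕜) →ₗ[𝕜] ℕ → ℕ → 𝕜 where
  toFun f := glueLines l 0 f
  map_add' f g := by ext t j; simp only [glueLines, Pi.add_apply]; split_ifs <;> simp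
  map_smul' a f := by ext t j; simp only [glueLines, Pi.smul_apply]; split_ifs <;> simp

theorem mem_hiddenSections_iff {f : ℕ → ℕ → 𝕜} :
    f ∈ hiddenSections 𝕜 n w ↔ f ∈ stackSections 𝕜 n w ∧ f 0 = 0 ∧ f w.length = 0 := by
  simp [hiddenSections, and_assoc]

theorem ker_outerLines_inf :
    closedSections c n (u ++ (p ++ v)) ⊓
      LinearMap.ker (outerLines 𝕜 u.length (u.length + p.length)) =
    (hiddenSections 𝕜 (width n u) p).map (padLines 𝕜 u.length) := by
  ext f
  constructor
  · rintro ⟨⟨hf, -⟩, hker⟩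
    obtain ⟨hkeep, hdrop⟩ := Prod.mk_eq_zero.1 hker
    obtain ⟨hp, -⟩ := mem_stackSections_append.1 (mem_stackSections_append.1 hf).2
    have hline : ∀ t, t ≤ u.length ∨ u.length + p.length ≤ t → f t = 0 := by
      rintro t (ht | ht)
      · rw [← keepLines_apply f ht, hkeep]; rfl
      · obtain ⟨k, rfl⟩ := Nat.exists_eq_add_of_le ht
        exact congrFun hdrop k
    refine ⟨_, mem_hiddenSections_iff.2 ⟨hp, ?_, ?_⟩, ?_⟩
    · rw [keepLines_apply _ (Nat.zero_le _)]; exact hline _ (by simp)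
    · rw [keepLines_apply _ le_rfl]; exact hline _ (by simp)
    · ext t : 1
      simp only [padLines, glueLines, LinearMap.coe_mk, AddHom.coe_mk, keepLines, dropLines_apply]
      split_ifs with h1 h2
      · exact (hline t (.inl h1)).symm
      · rw [Nat.add_sub_cancel' (by omega)]
      · exact (hline t (by omega)).symm
  · rintro ⟨g, hg, rfl⟩
    obtain ⟨hg, htop, hbottom⟩ := mem_hiddenSections_iff.1 hg
    have hpad : padLines 𝕜 u.length g = glueLines u.length 0 (glueLines p.length g 0) := by
      ext t : 1
      simp only [padLines, glueLines, LinearMap.coe_mk, AddHom.coe_mk]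
      split_ifs with h1 h2
      · rfl
      · rfl
      · ext j
        exact hg.1 _ j fun h => h2 h.1
    rw [hpad]
    exact glueLines_mem_closedSections (zero_mem _) hg (zero_mem _) htop.symm hbottom
      fun j _ _ => by simp

theorem padLines_injective {l m : ℕ} : Function.Injective
    ((padLines 𝕜 l).domRestrict (hiddenSections 𝕜 m p)) := by
  refine (injective_iff_map_eq_zero _).2 fun g hg => Subtype.ext ?_
  have hhidden := mem_hiddenSections_iff.1 g.2
  rw [← dropLines_glueLines (l := l) (g := 0) (h := g.1) hhidden.2.1.symm,
    show glueLines l 0 g.1 = 0 from hg, map_zero]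
  rfl

theorem finrank_closedSections_append :
    Module.finrank 𝕜 (closedSections c n (u ++ (p ++ v))) =
      Module.finrank 𝕜 ((closedSections c n (u ++ (p ++ v))).map
        (outerLines 𝕜 u.length (u.length + p.length))) +
      Module.finrank 𝕜 (hiddenSections 𝕜 (width n u) p) := by
  set V := closedSections c n (u ++ (p ++ v))
  set ρ := outerLines 𝕜 u.length (u.length + p.length)
  have hker : Module.finrank 𝕜 (LinearMap.ker (ρ.domRestrict V)) =
      Module.finrank 𝕜 (hiddenSections 𝕜 (width n u) p) := by
    rw [(LinearEquiv.ofInjective _ padLines_injective).finrank_eq, LinearMap.range_domRestrict,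
      ← ker_outerLines_inf (c := c), LinearMap.ker_domRestrict, ← Submodule.map_comap_subtype,
      Submodule.finrank_map_subtype_eq]
  rw [← LinearMap.finrank_range_add_finrank_ker (ρ.domRestrict V), hker,
    LinearMap.range_domRestrict]

theorem finrank_closedSections_replace {p' : List Slice}
    (hwidth : width (width n u) p = width (width n u) p')
    (hbdry : ∀ x z : ℕ → 𝕜, IsBoundary (width n u) p x z ↔ IsBoundary (width n u) p' x z) :
    Module.finrank 𝕜 (closedSections c n (u ++ (p ++ v))) +
        Module.finrank 𝕜 (hiddenSections 𝕜 (width n u) p') =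
      Module.finrank 𝕜 (closedSections c n (u ++ (p' ++ v))) +
        Module.finrank 𝕜 (hiddenSections 𝕜 (width n u) p) := by
  have hmap : (closedSections c n (u ++ (p ++ v))).map (outerLines 𝕜 u.length (u.length + p.length))
      = (closedSections c n (u ++ (p' ++ v))).map
        (outerLines 𝕜 u.length (u.length + p'.length)) := by
    ext a
    simp only [mem_map_outerLines_iff, width_append, hwidth, hbdry]
  rw [finrank_closedSections_append, hmap, finrank_closedSections_append (p := p')]
  ring

end Cut

/-- The relation `p = dᵏ q` between stacks `p`, `q` of slices with `m` points at the top: removal of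
a circle, straightening of a strand, and exchange of distant slices. -/
inductive LocalRel (m : ℕ) : List Slice → ℕ → List Slice → Prop
  | circle (i : ℕ) (h : i ≤ m) : LocalRel m [.cup i, .cap i] 1 []
  | cup_cap_succ (i : ℕ) (h : i < m) : LocalRel m [.cup i, .cap (i + 1)] 0 []
  | cup_succ_cap (i : ℕ) (h : i < m) : LocalRel m [.cup (i + 1), .cap i] 0 []
  | cup_cap_left (i j : ℕ) (h : i ≤ j) (hj : j + 2 ≤ m) :
      LocalRel m [.cup (j + 2), .cap i] 0 [.cap i, .cup j]
  | cup_cap_right (i j : ℕ) (h : j ≤ i) (hi : i + 2 ≤ m) :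
      LocalRel m [.cup j, .cap (i + 2)] 0 [.cap i, .cup j]
  | cap_cap (i j : ℕ) (h : i ≤ j) (hj : j + 4 ≤ m) :
      LocalRel m [.cap (j + 2), .cap i] 0 [.cap i, .cap j]
  | cup_cup (i j : ℕ) (h : i ≤ j) (hj : j ≤ m) :
      LocalRel m [.cup j, .cup i] 0 [.cup i, .cup (j + 2)]

section LocalRelations

variable {𝕜 : Type*} [Field 𝕜] {m k : ℕ} {s s' : Slice} {p q : List Slice}

/-- The function vanishes at the positions that do not occur on a line of `m` points. -/
def SupportedOn (m : ℕ) (x : ℕ → 𝕜) : Prop := ∀ j, m ≤ j → x j = 0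

/-- The functions `x`, `y` on the top and the bottom line of a slice with `m` points on its top line
are constant along its arcs. -/
structure Slice.Carries (m : ℕ) (s : Slice) (x y : ℕ → 𝕜) : Prop where
  top : SupportedOn m x
  bottom : SupportedOn (s.below m) y
  agree : s.Agree m x y

/-- The function on a line with two more points that has the value `a` at the new positions `i`,
`i + 1`. -/
def openTwo (i : ℕ) (a : 𝕜) (x : ℕ → 𝕜) (k : ℕ) : 𝕜 :=
  if k < i then x k else if k < i + 2 then a else x (k - 2)

section OpenTwo

variable {i j : ℕ} {a b : 𝕜} {x y z : ℕ → 𝕜}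

omit [Field 𝕜] in
theorem openTwo_insertTwo (i k : ℕ) (a : 𝕜) (x : ℕ → 𝕜) : openTwo i a x (insertTwo i k) = x k := by
  unfold openTwo insertTwo
  grind

omit [Field 𝕜] in
theorem openTwo_injective (h : openTwo i a x = openTwo i b y) : x = y := by
  funext k
  rw [← openTwo_insertTwo i k a x, h, openTwo_insertTwo]

omit [Field 𝕜] in
theorem openTwo_left_cancel (h : openTwo i a x = openTwo (i + 1) b y) : x = y := by
  funext k
  have h0 := congrFun h k
  have h1 := congrFun h (k + 1)
  have h2 := congrFun h (k + 2)
  simp only [openTwo] at h0 h1 h2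
  grind

omit [Field 𝕜] in
theorem openTwo_self (i : ℕ) (x : ℕ → 𝕜) : openTwo i (x i) x = openTwo (i + 1) (x i) x := by
  funext k
  unfold openTwo
  grind

omit [Field 𝕜] in
theorem openTwo_comm (h : i ≤ j) (a b : 𝕜) (x : ℕ → 𝕜) :
    openTwo (j + 2) a (openTwo i b x) = openTwo i b (openTwo j a x) := by
  funext k
  unfold openTwo
  grind

omit [Field 𝕜] in
theorem openTwo_eq_openTwo_iff (h : i ≤ j) :
    openTwo (j + 2) a x = openTwo i b z ↔ ∃ y, x = openTwo i b y ∧ z = openTwo j a y := by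
  constructor
  · intro heq
    refine ⟨x ∘ insertTwo i, funext fun k => ?_, funext fun k => ?_⟩
    · have h0 := congrFun heq k
      simp only [openTwo, insertTwo, Function.comp_apply] at h0 ⊢
      grind
    · rw [← openTwo_insertTwo i k b z, ← heq]
      simp only [openTwo, insertTwo, Function.comp_apply]
      grind
  · rintro ⟨y, rfl, rfl⟩
    exact openTwo_comm h a b y

theorem openTwo_eq_zero_iff : openTwo i a x = 0 ↔ a = 0 ∧ x = 0 := by
  constructor
  · intro h
    refine ⟨by simpa [openTwo] using congrFun h i, funext fun k => ?_⟩
    rw [← openTwo_insertTwo i k a x, h]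
    rfl
  · rintro ⟨rfl, rfl⟩
    funext k
    simp [openTwo]

theorem SupportedOn.openTwo (hi : i ≤ m) (hx : SupportedOn m x) (a : 𝕜) :
    SupportedOn (m + 2) (openTwo i a x) := fun k hk => by
  rw [ThetaNet.openTwo, if_neg (by omega), if_neg (by omega), hx _ (by omega)]

theorem SupportedOn.of_openTwo (hi : i + 2 ≤ m) (h : SupportedOn m (ThetaNet.openTwo i a x)) :
    SupportedOn (m - 2) x := fun k hk => by
  rw [← openTwo_insertTwo i k a x, insertTwo, if_neg (by omega), h _ (by omega)]

theorem agreeAcross_iff (hi : i + 2 ≤ m) (hx : SupportedOn m x) (hy : SupportedOn (m - 2) y) :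
    AgreeAcross m i x y ↔ ∃ a, x = openTwo i a y := by
  constructor
  · rintro ⟨hturn, hacross⟩
    refine ⟨x i, funext fun k => ?_⟩
    by_cases hk : k < m
    · have h0 := hacross k
      have h2 := hacross (k - 2)
      simp only [insertTwo, openTwo] at *
      grind
    · rw [hx k (by omega), openTwo, if_neg (by omega), if_neg (by omega), hy _ (by omega)]
  · rintro ⟨a, rfl⟩
    exact ⟨fun _ => by simp [openTwo], fun k _ => (openTwo_insertTwo i k a y).symm⟩

theorem carries_cap_iff (hi : i + 2 ≤ m) :
    (Slice.cap i).Carries m x y ↔ SupportedOn m x ∧ ∃ a, x = openTwo i a y := by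
  constructor
  · rintro ⟨hx, hy, h⟩
    exact ⟨hx, (agreeAcross_iff hi hx hy).1 h⟩
  · rintro ⟨hx, a, rfl⟩
    have hy := hx.of_openTwo hi
    exact ⟨hx, hy, (agreeAcross_iff hi hx hy).2 ⟨a, rfl⟩⟩

theorem carries_cup_iff (hi : i ≤ m) :
    (Slice.cup i).Carries m x y ↔ SupportedOn m x ∧ ∃ a, y = openTwo i a x := by
  have hi' : i + 2 ≤ m + 2 := by omega
  constructor
  · rintro ⟨hx, hy, h⟩
    exact ⟨hx, (agreeAcross_iff hi' hy hx).1 h⟩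
  · rintro ⟨hx, a, rfl⟩
    have hy := hx.openTwo hi a
    exact ⟨hx, hy, (agreeAcross_iff hi' hy hx).2 ⟨a, rfl⟩⟩

end OpenTwo

theorem mem_stackSections_pair {f : ℕ → ℕ → 𝕜} :
    f ∈ stackSections 𝕜 m [s, s'] ↔ s.Carries m (f 0) (f 1) ∧ s'.Carries (s.below m) (f 1) (f 2) ∧
      ∀ t, 2 < t → f t = 0 := by
  rw [mem_stackSections_iff]
  constructor
  · rintro ⟨h0, h⟩
    have hsupp : ∀ t ≤ 2, SupportedOn (width m ([s, s'].take t)) (f t) := fun t _ j hj =>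
      h0 t j fun hp => hj.not_gt hp.2
    exact ⟨⟨hsupp 0 (by simp), hsupp 1 (by simp), h 0 s rfl⟩,
      ⟨hsupp 1 (by simp), hsupp 2 le_rfl, h 1 s' rfl⟩,
      fun t ht => funext fun j => h0 t j fun hp => ht.not_ge hp.1⟩
  · rintro ⟨hs, hs', h⟩
    refine ⟨fun t j ht => ?_, fun t r ht => ?_⟩
    · match t with
      | 0 => exact hs.top j (by simpa [IsPoint, width] using ht)
      | 1 => exact hs.bottom j (by simpa [IsPoint, width] using ht)
      | 2 => exact hs'.bottom j (by simpa [IsPoint, width] using ht)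
      | t + 3 => rw [h _ (by omega)]; rfl
    · match t with
      | 0 => obtain rfl : s = r := by simpa using ht
             exact hs.agree
      | 1 => obtain rfl : s' = r := by simpa using ht
             exact hs'.agree
      | t + 2 => simp at ht

theorem isBoundary_pair {x z : ℕ → 𝕜} :
    IsBoundary m [s, s'] x z ↔ ∃ y, s.Carries m x y ∧ s'.Carries (s.below m) y z := by
  constructor
  · rintro ⟨f, hf, rfl, rfl⟩
    obtain ⟨hs, hs', -⟩ := mem_stackSections_pair.1 hf
    exact ⟨_, hs, hs'⟩
  · rintro ⟨y, hs, hs'⟩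
    let f : ℕ → ℕ → 𝕜
      | 0 => x
      | 1 => y
      | 2 => z
      | _ + 3 => 0
    refine ⟨f, mem_stackSections_pair.2 ⟨hs, hs', fun t ht => ?_⟩, rfl, rfl⟩
    obtain ⟨t, rfl⟩ := Nat.exists_eq_add_of_le' ht
    rfl

theorem isBoundary_nil {x z : ℕ → 𝕜} : IsBoundary m [] x z ↔ SupportedOn m x ∧ x = z := by
  constructor
  · rintro ⟨f, hf, rfl, rfl⟩
    exact ⟨fun j hj => hf.1 0 j (by simpa [IsPoint, width] using hj), rfl⟩
  · rintro ⟨hx, rfl⟩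
    refine ⟨keepLines 𝕜 0 fun _ => x, mem_stackSections_iff.2 ⟨fun t j ht => ?_, by simp⟩,
      by simp [keepLines], by simp [keepLines]⟩
    cases t with
    | zero => exact hx j (by simpa [IsPoint, width] using ht)
    | succ t => rfl

section PairBoundary

variable {i j : ℕ} {x z : ℕ → 𝕜}

theorem isBoundary_cup_cap (hi : i ≤ m) (hj : j ≤ m) :
    IsBoundary m [.cup i, .cap j] x z ↔
      SupportedOn m x ∧ ∃ a b, openTwo i a x = openTwo j b z := by
  rw [isBoundary_pair]
  constructor
  · rintro ⟨y, hs, hs'⟩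
    obtain ⟨hx, a, rfl⟩ := (carries_cup_iff hi).1 hs
    obtain ⟨-, b, hb⟩ := (carries_cap_iff (by simp [Slice.below, hj])).1 hs'
    exact ⟨hx, a, b, hb⟩
  · rintro ⟨hx, a, b, h⟩
    exact ⟨_, (carries_cup_iff hi).2 ⟨hx, a, rfl⟩,
      (carries_cap_iff (by simp [Slice.below, hj])).2 ⟨hx.openTwo hi a, b, h⟩⟩

theorem isBoundary_cap_cup (hi : i + 2 ≤ m) (hj : j + 2 ≤ m) :
    IsBoundary m [.cap i, .cup j] x z ↔
      SupportedOn m x ∧ ∃ a b y, x = openTwo i a y ∧ z = openTwo j b y := by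
  rw [isBoundary_pair]
  have hj' : j ≤ (Slice.cap i).below m := by simp only [Slice.below]; omega
  constructor
  · rintro ⟨y, hs, hs'⟩
    obtain ⟨hx, a, ha⟩ := (carries_cap_iff hi).1 hs
    obtain ⟨-, b, hb⟩ := (carries_cup_iff hj').1 hs'
    exact ⟨hx, a, b, y, ha, hb⟩
  · rintro ⟨hx, a, b, y, rfl, hb⟩
    exact ⟨_, (carries_cap_iff hi).2 ⟨hx, a, rfl⟩,
      (carries_cup_iff hj').2 ⟨hx.of_openTwo hi, b, hb⟩⟩

theorem isBoundary_cap_cap (hi : i + 2 ≤ m) (hj : j + 4 ≤ m) :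
    IsBoundary m [.cap i, .cap j] x z ↔
      SupportedOn m x ∧ ∃ a b, x = openTwo i a (openTwo j b z) := by
  rw [isBoundary_pair]
  have hj' : j + 2 ≤ (Slice.cap i).below m := by simp only [Slice.below]; omega
  constructor
  · rintro ⟨y, hs, hs'⟩
    obtain ⟨hx, a, rfl⟩ := (carries_cap_iff hi).1 hs
    obtain ⟨-, b, rfl⟩ := (carries_cap_iff hj').1 hs'
    exact ⟨hx, a, b, rfl⟩
  · rintro ⟨hx, a, b, rfl⟩
    exact ⟨_, (carries_cap_iff hi).2 ⟨hx, a, rfl⟩,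
      (carries_cap_iff hj').2 ⟨hx.of_openTwo hi, b, rfl⟩⟩

theorem isBoundary_cup_cup (hi : i ≤ m) (hj : j ≤ m + 2) :
    IsBoundary m [.cup i, .cup j] x z ↔
      SupportedOn m x ∧ ∃ a b, z = openTwo j b (openTwo i a x) := by
  rw [isBoundary_pair]
  constructor
  · rintro ⟨y, hs, hs'⟩
    obtain ⟨hx, a, rfl⟩ := (carries_cup_iff hi).1 hs
    obtain ⟨-, b, rfl⟩ := (carries_cup_iff hj).1 hs'
    exact ⟨hx, a, b, rfl⟩
  · rintro ⟨hx, a, b, rfl⟩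
    exact ⟨_, (carries_cup_iff hi).2 ⟨hx, a, rfl⟩,
      (carries_cup_iff hj).2 ⟨hx.openTwo hi a, b, rfl⟩⟩

end PairBoundary

theorem LocalRel.width_eq (h : LocalRel m p k q) : width m p = width m q := by
  cases h <;> simp [width, Slice.below] <;> omega

theorem LocalRel.isBoundary_iff (h : LocalRel m p k q) (x z : ℕ → 𝕜) :
    IsBoundary m p x z ↔ IsBoundary m q x z := by
  cases h
  case circle i h =>
    rw [isBoundary_cup_cap h h, isBoundary_nil]
    refine and_congr_right fun _ => ⟨?_, ?_⟩
    · rintro ⟨a, b, hab⟩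
      exact openTwo_injective hab
    · rintro rfl
      exact ⟨0, 0, rfl⟩
  case cup_cap_succ i h =>
    rw [isBoundary_cup_cap h.le h, isBoundary_nil]
    refine and_congr_right fun _ => ⟨?_, ?_⟩
    · rintro ⟨a, b, hab⟩
      exact openTwo_left_cancel hab
    · rintro rfl
      exact ⟨x i, x i, openTwo_self i x⟩
  case cup_succ_cap i h =>
    rw [isBoundary_cup_cap h h.le, isBoundary_nil]
    refine and_congr_right fun _ => ⟨?_, ?_⟩
    · rintro ⟨a, b, hab⟩
      exact (openTwo_left_cancel hab.symm).symm
    · rintro rfl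
      exact ⟨x i, x i, (openTwo_self i x).symm⟩
  case cup_cap_left i j h hj =>
    rw [isBoundary_cup_cap hj (by omega), isBoundary_cap_cup (by omega) hj, exists_comm]
    simp only [openTwo_eq_openTwo_iff h]
  case cup_cap_right i j h hi =>
    rw [isBoundary_cup_cap (by omega) hi, isBoundary_cap_cup hi (by omega), exists_comm]
    simp only [eq_comm (a := openTwo j _ x), openTwo_eq_openTwo_iff h, and_comm]
  case cap_cap i j h hj =>
    rw [isBoundary_cap_cap (by omega) (by omega), isBoundary_cap_cap (by omega) hj, exists_comm]
    simp only [openTwo_comm h]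
  case cup_cup i j h hj =>
    rw [isBoundary_cup_cup hj (by omega), isBoundary_cup_cup (by omega) (by omega), exists_comm]
    simp only [openTwo_comm h]

theorem mem_hiddenSections_pair {f : ℕ → ℕ → 𝕜} :
    f ∈ hiddenSections 𝕜 m [s, s'] ↔
      s.Carries m 0 (f 1) ∧ s'.Carries (s.below m) (f 1) 0 ∧ ∀ t, t ≠ 1 → f t = 0 := by
  rw [mem_hiddenSections_iff, mem_stackSections_pair]
  constructor
  · rintro ⟨⟨hs, hs', h3⟩, h0, h2 : f 2 = 0⟩
    rw [h0] at hs
    rw [h2] at hs'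
    refine ⟨hs, hs', fun t ht => ?_⟩
    match t with
    | 0 => exact h0
    | 2 => exact h2
    | t + 3 => exact h3 _ (by omega)
  · rintro ⟨hs, hs', h⟩
    have h0 := h 0 (by simp)
    have h2 := h 2 (by simp)
    exact ⟨⟨by rwa [h0], by rwa [h2], fun t ht => h t (by omega)⟩, h0, h2⟩

theorem hiddenSections_nil : hiddenSections 𝕜 m [] = ⊥ := by
  refine eq_bot_iff.2 fun f hf => funext fun t => ?_
  obtain ⟨hf, h0, -⟩ := mem_hiddenSections_iff.1 hf
  cases t with
  | zero => exact h0
  | succ t => exact funext fun j => hf.1 _ j fun h => by simp [IsPoint] at h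

theorem hiddenSections_pair_eq_bot
    (h : ∀ y : ℕ → 𝕜, s.Carries m 0 y → s'.Carries (s.below m) y 0 → y = 0) :
    hiddenSections 𝕜 m [s, s'] = ⊥ := by
  refine eq_bot_iff.2 fun f hf => funext fun t => ?_
  obtain ⟨hs, hs', h0⟩ := mem_hiddenSections_pair.1 hf
  by_cases ht : t = 1
  · rw [ht, h _ hs hs']; rfl
  · rw [h0 t ht]; rfl

theorem hiddenSections_cap {i : ℕ} (hi : i + 2 ≤ m) : hiddenSections 𝕜 m [.cap i, s] = ⊥ :=
  hiddenSections_pair_eq_bot fun y hs _ => by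
    obtain ⟨-, a, ha⟩ := (carries_cap_iff hi).1 hs
    exact (openTwo_eq_zero_iff.1 ha.symm).2

theorem hiddenSections_cup {i : ℕ} (hi : i ≤ s.below m) : hiddenSections 𝕜 m [s, .cup i] = ⊥ :=
  hiddenSections_pair_eq_bot fun y _ hs => by
    obtain ⟨-, a, ha⟩ := (carries_cup_iff hi).1 hs
    exact (openTwo_eq_zero_iff.1 ha.symm).2

theorem openTwo_zero_eq_zero {i j : ℕ} {a b : 𝕜} (hij : i ≠ j)
    (h : openTwo i a 0 = openTwo j b 0) : openTwo i a 0 = 0 := by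
  have hi := congrFun h i
  have hi' := congrFun h (i + 1)
  simp only [openTwo, Pi.zero_apply] at hi hi'
  refine openTwo_eq_zero_iff.2 ⟨?_, rfl⟩
  grind

theorem hiddenSections_cup_cap {i j : ℕ} (hi : i ≤ m) (hj : j ≤ m) (hij : i ≠ j) :
    hiddenSections 𝕜 m [.cup i, .cap j] = ⊥ :=
  hiddenSections_pair_eq_bot fun y hs hs' => by
    obtain ⟨-, a, rfl⟩ := (carries_cup_iff hi).1 hs
    obtain ⟨-, b, hb⟩ := (carries_cap_iff (by simp [Slice.below, hj])).1 hs'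
    exact openTwo_zero_eq_zero hij hb

theorem finrank_hiddenSections_circle {i : ℕ} (hi : i ≤ m) :
    Module.finrank 𝕜 (hiddenSections 𝕜 m [.cup i, .cap i]) = 1 := by
  let g : ℕ → ℕ → 𝕜 := Pi.single 1 (openTwo i 1 0)
  have hi' : i + 2 ≤ (Slice.cup i).below m := by simp [Slice.below, hi]
  have hzero : SupportedOn m (0 : ℕ → 𝕜) := fun _ _ => rfl
  have hg : g ∈ hiddenSections 𝕜 m [.cup i, .cap i] := by
    refine mem_hiddenSections_pair.2 ⟨?_, ?_, fun t ht => Pi.single_eq_of_ne ht _⟩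
    · exact (carries_cup_iff hi).2 ⟨hzero, 1, Pi.single_eq_same _ _⟩
    · rw [carries_cap_iff hi']
      simp only [g, Pi.single_eq_same]
      exact ⟨hzero.openTwo hi 1, 1, rfl⟩
  refine finrank_eq_one ⟨g, hg⟩ (fun h => ?_) fun f => ?_
  · simpa [g, openTwo] using congrFun (congrFun (congrArg Subtype.val h) 1) i
  · obtain ⟨hs, -, h0⟩ := mem_hiddenSections_pair.1 f.2
    obtain ⟨-, a, ha⟩ := (carries_cup_iff hi).1 hs
    refine ⟨a, Subtype.ext (funext fun t => ?_)⟩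
    by_cases ht : t = 1
    · subst ht
      rw [ha]
      funext k
      simp [g, openTwo]
    · rw [h0 t ht]
      simp [g, ht]

theorem LocalRel.hiddenSections_eq_bot (h : LocalRel m p k q) : hiddenSections 𝕜 m q = ⊥ := by
  cases h
  case cup_cap_left | cup_cap_right | cap_cap => exact hiddenSections_cap (by omega)
  case cup_cup => exact hiddenSections_cup (by simp only [Slice.below]; omega)
  all_goals exact hiddenSections_nil

theorem LocalRel.finrank_hiddenSections (h : LocalRel m p k q) :
    Module.finrank 𝕜 (hiddenSections 𝕜 m p) = k := by
  cases h
  case circle i hi => exact finrank_hiddenSections_circle hi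
  case cap_cap => rw [hiddenSections_cap (by omega), finrank_bot]
  case cup_cup => rw [hiddenSections_cup (by simp only [Slice.below]; omega), finrank_bot]
  all_goals rw [hiddenSections_cup_cap (by omega) (by omega) (by omega), finrank_bot]

theorem LocalRel.annularBracket_eq {n : ℕ} {u : List Slice} (h : LocalRel (width n u) p k q)
    (v : List Slice) :
    annularBracket n (u ++ (p ++ v)) = Polynomial.C (d ^ k) * annularBracket n (u ++ (q ++ v)) :=
  annularBracket_eq_of_finrank fun c => by
    have := finrank_closedSections_replace (c := c) (v := v) h.width_eq h.isBoundary_iff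
    rwa [h.hiddenSections_eq_bot, finrank_bot, add_zero, h.finrank_hiddenSections] at this

end LocalRelations

section Rotation

variable {𝕜 : Type*} [Field 𝕜] {c : 𝕜ˣ} {n : ℕ} {u v w : List Slice}

theorem apply_zero_eq_smul {f : ℕ → ℕ → 𝕜} (hw : width n w = n) (hf : f ∈ closedSections c n w) :
    f 0 = c • f w.length := by
  funext j
  by_cases hj : j < n
  · exact hf.2 j hj (hj.trans_eq hw.symm)
  · rw [Pi.smul_apply, hf.1.1 0 j fun h => hj (isPoint_highest_iff.1 h),
      hf.1.1 _ j fun h => hj (hw ▸ isPoint_lowest_iff.1 h), smul_zero]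

/-- The effect on a function of moving the top `l` lines of a closed stack below the other `l'`
lines; the moved part crosses the closing arcs, whence the factor `c⁻¹`. -/
def rotateLines (c : 𝕜ˣ) (l l' : ℕ) : (ℕ → ℕ → 𝕜) →ₗ[𝕜] ℕ → ℕ → 𝕜 where
  toFun f := glueLines l' (dropLines 𝕜 l f) (c⁻¹ • keepLines 𝕜 l f)
  map_add' f g := by
    ext t j
    simp only [glueLines, map_add, Pi.add_apply, smul_add]
    split_ifs <;> rfl
  map_smul' a f := by
    ext t j
    simp only [glueLines, map_smul, Pi.smul_apply, smul_comm c⁻¹ a, RingHom.id_apply]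
    split_ifs <;> rfl

theorem keepLines_rotateLines {f : ℕ → ℕ → 𝕜} (hf : f ∈ stackSections 𝕜 n (u ++ v)) :
    keepLines 𝕜 v.length (rotateLines c u.length v.length f) = dropLines 𝕜 u.length f :=
  keepLines_glueLines.trans (keepLines_eq_self (mem_stackSections_append.1 hf).2)

theorem dropLines_rotateLines {f : ℕ → ℕ → 𝕜} (hw : width n (u ++ v) = n)
    (hf : f ∈ closedSections c n (u ++ v)) :
    dropLines 𝕜 v.length (rotateLines c u.length v.length f) = c⁻¹ • keepLines 𝕜 u.length f := by
  refine dropLines_glueLines ?_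
  rw [dropLines_apply, Pi.smul_apply, keepLines_apply f (Nat.zero_le _), apply_zero_eq_smul hw hf,
    inv_smul_smul, List.length_append]

theorem rotateLines_mem_closedSections {f : ℕ → ℕ → 𝕜} (hw : width n (u ++ v) = n)
    (hf : f ∈ closedSections c n (u ++ v)) :
    rotateLines c u.length v.length f ∈ closedSections c (width n u) (v ++ u) := by
  obtain ⟨hu, hv⟩ := mem_stackSections_append.1 hf.1
  have hkeep := keepLines_rotateLines (c := c) hf.1
  have hdrop := dropLines_rotateLines hw hf
  refine ⟨mem_stackSections_append.2 ⟨hkeep ▸ hv, ?_⟩, fun j _ _ => ?_⟩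
  · rw [hdrop, ← width_append, hw]
    exact Submodule.smul_mem _ (c⁻¹ : 𝕜ˣ).val hu
  · have htop := congrFun (congrFun hkeep 0) j
    have hbottom := congrFun (congrFun hdrop u.length) j
    rw [keepLines_apply _ (Nat.zero_le _), dropLines_apply, add_zero] at htop
    rw [dropLines_apply, Pi.smul_apply, keepLines_apply f le_rfl, Pi.smul_apply, Units.smul_def,
      smul_eq_mul] at hbottom
    rw [List.length_append, htop, hbottom, Units.mul_inv_cancel_left]

theorem rotateLines_injective (hw : width n (u ++ v) = n) : Function.Injective
    ((rotateLines c u.length v.length).restrict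
      fun _ hf => rotateLines_mem_closedSections (c := c) hw hf) := by
  refine (injective_iff_map_eq_zero _).2 fun ⟨f, hf⟩ h0 => Subtype.ext (funext fun t => ?_)
  have hrot : rotateLines c u.length v.length f = 0 := congrArg Subtype.val h0
  have hdrop : dropLines 𝕜 u.length f = 0 := by
    rw [← keepLines_rotateLines (c := c) hf.1, hrot, map_zero]
  have hkeep : keepLines 𝕜 u.length f = 0 := by
    rw [← smul_eq_zero_iff_eq c⁻¹, ← dropLines_rotateLines hw hf, hrot, map_zero]
  change f t = 0
  rcases le_total t u.length with ht | ht
  · rw [← keepLines_apply f ht, hkeep]; rfl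
  · obtain ⟨k, rfl⟩ := Nat.exists_eq_add_of_le ht
    exact congrFun hdrop k

theorem finrank_closedSections_rotate (hw : width n (u ++ v) = n) :
    Module.finrank 𝕜 (closedSections c n (u ++ v)) =
      Module.finrank 𝕜 (closedSections c (width n u) (v ++ u)) := by
  have hw' : width (width n u) v = n := by rw [← width_append, hw]
  have hback := LinearMap.finrank_le_finrank_of_injective
    (rotateLines_injective (c := c) (n := width n u) (u := v) (v := u) (by rw [width_append, hw']))
  rw [hw'] at hback
  exact (LinearMap.finrank_le_finrank_of_injective (rotateLines_injective hw)).antisymm hback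

theorem finrank_closedSections_nil_one :
    Module.finrank 𝕜 (closedSections (1 : 𝕜ˣ) n []) = n := by
  let ρ : closedSections (1 : 𝕜ˣ) n [] →ₗ[𝕜] Fin n → 𝕜 :=
    LinearMap.pi fun i => LinearMap.proj (i : ℕ) ∘ₗ LinearMap.proj 0 ∘ₗ Submodule.subtype _
  have hpoint (t j : ℕ) : IsPoint n [] (t, j) ↔ t = 0 ∧ j < n := by simp [IsPoint, width]
  have hinj : Function.Injective ρ := (injective_iff_map_eq_zero _).2 fun f hf => by
    ext t j
    by_cases h : t = 0 ∧ j < n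
    · obtain ⟨rfl, hj⟩ := h
      exact congrFun hf ⟨j, hj⟩
    · exact f.2.1.1 t j (mt (hpoint t j).1 h)
  have hsurj : Function.Surjective ρ := fun g => by
    let f t j := if h : t = 0 ∧ j < n then g ⟨j, h.2⟩ else 0
    have hf : f ∈ stackSections 𝕜 n [] :=
      mem_stackSections_iff.2 ⟨fun t j h => dif_neg (mt (hpoint t j).2 h), by simp⟩
    refine ⟨⟨f, hf, fun j _ _ => by simp⟩, funext fun i => ?_⟩
    exact dif_pos ⟨rfl, i.2⟩
  rw [(LinearEquiv.ofBijective ρ ⟨hinj, hsurj⟩).finrank_eq, Module.finrank_fin_fun]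

theorem closedSections_nil (hc : c ≠ 1) : closedSections c n [] = ⊥ := by
  refine eq_bot_iff.2 fun f hf => funext fun t => funext fun j => ?_
  by_cases h : IsPoint n [] (t, j)
  · obtain rfl : t = 0 := by simpa using h.1
    have hj := congrFun (apply_zero_eq_smul rfl hf) j
    by_contra hne
    exact hc (Units.ext (mul_right_cancel₀ hne (hj.symm.trans (one_mul _).symm)))
  · exact hf.1.1 t j h

end Rotation

theorem annularBracket_rotate {n : ℕ} {u v : List Slice} (hw : width n (u ++ v) = n) :
    annularBracket n (u ++ v) = annularBracket (width n u) (v ++ u) := by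
  rw [annularBracket_eq_of_finrank (k := 0) fun c => finrank_closedSections_rotate hw, pow_zero,
    C_1, one_mul]

theorem annularBracket_nil (n : ℕ) : annularBracket n [] = X ^ n := by
  have htrivial := finrank_closedSections_two n []
  rw [closedSections_nil (by simp [Units.ext_iff]), finrank_bot] at htrivial
  have hall := card_not_essential_add_card_essential n []
  rw [← htrivial, zero_add, ← finrank_closedSections_one, finrank_closedSections_nil_one] at hall
  rw [annularBracket, ← htrivial, hall, pow_zero, C_1, one_mul]

noncomputable section

variable {N k : ℕ} {u v w w' : List Slice}

@[simp] theorem width_nil (n : ℕ) : width n [] = n := rfl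

@[simp] theorem width_cons (n : ℕ) (s : Slice) (w : List Slice) :
    width n (s :: w) = width (s.below n) w := rfl

@[simp] theorem diagram_nil : diagram [] = 1 := map_one _

theorem diagram_append (u v : List Slice) : diagram (u ++ v) = diagram u * diagram v :=
  map_mul (MonoidAlgebra.of K (FreeMonoid Slice)) (FreeMonoid.ofList u) (FreeMonoid.ofList v)

theorem span_range_diagram : Submodule.span K (Set.range diagram) = ⊤ := by
  refine eq_top_iff.2 fun x _ => ?_
  induction x using MonoidAlgebra.induction_on with
  | of w => exact Submodule.subset_span ⟨w.toList, rfl⟩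
  | add x y hx hy => exact add_mem (hx trivial) (hy trivial)
  | smul r x hx => exact Submodule.smul_mem _ r (hx trivial)

/-- `annularTrace` as a linear map. -/
def annularTraceₗ (n : ℕ) : Tangles →ₗ[K] K[X] :=
  Finsupp.linearCombination K (fun w : FreeMonoid Slice => annularBracket n w.toList) ∘ₗ
    (MonoidAlgebra.coeffLinearEquiv K).toLinearMap

theorem annularTraceₗ_apply (n : ℕ) (f : Tangles) : annularTraceₗ n f = annularTrace n f := rfl

@[simp] theorem annularTraceₗ_diagram (n : ℕ) (w : List Slice) :
    annularTraceₗ n (diagram w) = annularBracket n w :=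
  (Finsupp.linearCombination_single K (1 : K) (FreeMonoid.ofList w)).trans (one_smul K _)

theorem planarTrace_eq_eval (n : ℕ) (f : Tangles) :
    planarTrace n f = (annularTrace n f).eval d := by
  simp only [planarTrace, annularTrace, Finsupp.sum, eval_finsetSum, eval_smul,
    eval_annularBracket]

/-- The span of the Kauffman skein relations between stacks with `N` points at the top. -/
def skeinRelations (N : ℕ) : Submodule K Tangles :=
  Submodule.span K {x | ∃ u p k q v, LocalRel (width N u) p k q ∧
    x = diagram (u ++ (p ++ v)) - d ^ k • diagram (u ++ (q ++ v))}

theorem LocalRel.smodEq {p q : List Slice} (h : LocalRel (width N u) p k q) (v : List Slice) :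
    diagram (u ++ (p ++ v)) ≡ d ^ k • diagram (u ++ (q ++ v)) [SMOD skeinRelations N] :=
  SModEq.sub_mem.2 (Submodule.subset_span ⟨u, p, k, q, v, h, rfl⟩)

theorem skeinRelations_le_ker_annularTraceₗ (N : ℕ) :
    skeinRelations N ≤ LinearMap.ker (annularTraceₗ N) := by
  refine Submodule.span_le.2 ?_
  rintro _ ⟨u, p, k, q, v, h, rfl⟩
  simp only [SetLike.mem_coe, LinearMap.mem_ker, map_sub, map_smul, annularTraceₗ_diagram,
    h.annularBracket_eq, smul_eq_C_mul, sub_self]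

theorem annularTraceₗ_eq_of_smodEq {x y : Tangles} (h : x ≡ y [SMOD skeinRelations N]) :
    annularTraceₗ N x = annularTraceₗ N y := by
  simpa only [LinearMap.mem_ker, map_sub, sub_eq_zero] using
    skeinRelations_le_ker_annularTraceₗ N (SModEq.sub_mem.1 h)

theorem annularBracket_eq_of_smodEq {c : K}
    (h : diagram w ≡ c • diagram w' [SMOD skeinRelations N]) :
    annularBracket N w = c • annularBracket N w' := by
  simpa only [map_smul, annularTraceₗ_diagram] using annularTraceₗ_eq_of_smodEq h

theorem skeinRelations_mul_le (N : ℕ) : skeinRelations N * ⊤ ≤ skeinRelations N := by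
  rw [← span_range_diagram, skeinRelations, Submodule.span_mul_span]
  refine Submodule.span_mono ?_
  rintro _ ⟨_, ⟨u, p, k, q, v, h, rfl⟩, _, ⟨w, rfl⟩, rfl⟩
  exact ⟨u, p, k, q, v ++ w, h, by
    simp only [sub_mul, smul_mul_assoc, ← diagram_append, List.append_assoc]⟩

theorem diagram_mul_mem_skeinRelations {x : Tangles} (hx : x ∈ skeinRelations (width N u)) :
    diagram u * x ∈ skeinRelations N := by
  suffices skeinRelations (width N u) ≤
      (skeinRelations N).comap (LinearMap.mulLeft K (diagram u)) from this hx
  refine Submodule.span_le.2 ?_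
  rintro _ ⟨u', p, k, q, v, h, rfl⟩
  refine Submodule.subset_span ⟨u ++ u', p, k, q, v, by rwa [width_append], ?_⟩
  simp only [LinearMap.mulLeft_apply, mul_sub, mul_smul_comm, ← diagram_append,
    List.append_assoc]

theorem smodEq_mul_right {x y : Tangles} (h : x ≡ y [SMOD skeinRelations N]) (z : Tangles) :
    x * z ≡ y * z [SMOD skeinRelations N] := by
  rw [SModEq.sub_mem, ← sub_mul]
  exact skeinRelations_mul_le N (Submodule.mul_mem_mul (SModEq.sub_mem.1 h) trivial)

theorem smodEq_diagram_mul {x y : Tangles} (h : x ≡ y [SMOD skeinRelations (width N u)]) :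
    diagram u * x ≡ diagram u * y [SMOD skeinRelations N] := by
  rw [SModEq.sub_mem, ← mul_sub]
  exact diagram_mul_mem_skeinRelations (SModEq.sub_mem.1 h)

theorem smodEq_append {c : K} (h : diagram w ≡ c • diagram w' [SMOD skeinRelations N])
    (v : List Slice) : diagram (w ++ v) ≡ c • diagram (w' ++ v) [SMOD skeinRelations N] := by
  simpa only [diagram_append, smul_mul_assoc] using smodEq_mul_right h (diagram v)

theorem width_mono {m n : ℕ} (h : m ≤ n) (w : List Slice) : width m w ≤ width n w := by
  induction w generalizing m n with
  | nil => exact h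
  | cons s _ ih => exact ih (by cases s <;> simp only [Slice.below] <;> omega)

theorem LocalRel.mono {m n : ℕ} (hmn : m ≤ n) {p q : List Slice} (h : LocalRel m p k q) :
    LocalRel n p k q := by
  cases h <;> constructor <;> omega

theorem skeinRelations_mono {m n : ℕ} (h : m ≤ n) : skeinRelations m ≤ skeinRelations n := by
  refine Submodule.span_mono ?_
  rintro _ ⟨u, p, k, q, v, hr, rfl⟩
  exact ⟨u, p, k, q, v, hr.mono (width_mono h u), rfl⟩

/-- A slice with `m` points on its top line fits if its cap joins two of them, or its cup is
inserted next to or between them. -/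
def Slice.Fits (m : ℕ) : Slice → Prop
  | .cap i => i + 2 ≤ m
  | .cup i => i ≤ m

/-- All slices of a stack fit on the strands that are present. On other stacks `width` is
meaningless, because `Slice.below` truncates. -/
def Valid : ℕ → List Slice → Prop
  | _, [] => True
  | n, s :: w => s.Fits n ∧ Valid (s.below n) w

theorem valid_append {n : ℕ} : Valid n (u ++ v) ↔ Valid n u ∧ Valid (width n u) v := by
  induction u generalizing n with
  | nil => simp [Valid]
  | cons s u ih => simp [Valid, ih, and_assoc]

theorem valid_singleton {n : ℕ} {s : Slice} : Valid n [s] ↔ s.Fits n := by simp [Valid]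

theorem Slice.Fits.add {s : Slice} (h : s.Fits N) (k : ℕ) : s.Fits (N + k) := by
  cases s <;> simp only [Slice.Fits] at h ⊢ <;> omega

theorem Slice.Fits.below_add {s : Slice} (h : s.Fits N) (k : ℕ) :
    s.below (N + k) = s.below N + k := by
  cases s <;> simp only [Slice.Fits, Slice.below] at h ⊢ <;> omega

theorem Valid.add (h : Valid N w) (k : ℕ) : Valid (N + k) w := by
  induction w generalizing N with
  | nil => trivial
  | cons s w ih => exact ⟨h.1.add k, h.1.below_add k ▸ ih h.2⟩

theorem Valid.width_add (h : Valid N w) (k : ℕ) : width (N + k) w = width N w + k := by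
  induction w generalizing N with
  | nil => rfl
  | cons s w ih => rw [width_cons, width_cons, h.1.below_add, ih h.2]

/-- A stack is reduced if it starts with a cap or consists of cups only. Every valid stack is a
multiple of a reduced one modulo the skein relations. -/
inductive IsReduced : List Slice → Prop
  | cap_cons (i : ℕ) (w : List Slice) : IsReduced (.cap i :: w)
  | cups (us : List ℕ) : IsReduced (us.map .cup)

/-- A stack is reducible if it is a multiple of a valid reduced stack modulo the skein
relations. -/
def IsReducible (N : ℕ) (w : List Slice) : Prop :=
  ∃ (c : K) (r : List Slice), IsReduced r ∧ Valid N r ∧ width N r = width N w ∧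
    diagram w ≡ c • diagram r [SMOD skeinRelations N]

theorem IsReduced.isReducible (h : IsReduced w) (hv : Valid N w) : IsReducible N w :=
  ⟨1, w, h, hv, rfl, by rw [one_smul]⟩

theorem IsReducible.of_smodEq {c : K} (h : IsReducible N w')
    (hw : diagram w ≡ c • diagram w' [SMOD skeinRelations N]) (hN : width N w' = width N w) :
    IsReducible N w := by
  obtain ⟨c', r, hr, hv, hrN, h⟩ := h
  exact ⟨c * c', r, hr, hv, hrN.trans hN, by rw [mul_smul]; exact hw.trans (h.smul c)⟩

theorem IsReduced.append_cup {j : ℕ} (h : IsReduced w) : IsReduced (w ++ [.cup j]) := by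
  cases h with
  | cap_cons i w => exact .cap_cons i _
  | cups us => simpa using IsReduced.cups (us ++ [j])

theorem IsReducible.append_cup {j : ℕ} (h : IsReducible N w) (hj : j ≤ width N w) :
    IsReducible N (w ++ [.cup j]) := by
  obtain ⟨c, r, hr, hv, hN, h⟩ := h
  refine (hr.append_cup.isReducible ?_).of_smodEq (smodEq_append h _) ?_
  · exact valid_append.2 ⟨hv, valid_singleton.2 (hN ▸ hj)⟩
  · rw [width_append, hN, width_append]

theorem isReducible_cups_cap {i : ℕ} {us : List ℕ} (h : Valid N (us.map .cup ++ [.cap i])) :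
    IsReducible N (us.map .cup ++ [.cap i]) := by
  induction us using List.reverseRecOn generalizing i with
  | nil => exact (IsReduced.cap_cons i []).isReducible h
  | append_singleton us j ih =>
    rw [List.map_append, List.append_assoc] at h ⊢
    obtain ⟨hus, hj, hi, -⟩ := valid_append.1 h
    set m := width N (us.map .cup)
    simp only [Slice.Fits, Slice.below] at hj hi
    have of_localRel {k : ℕ} {q : List Slice} (hq : LocalRel m [.cup j, .cap i] k q)
        (hr : IsReducible N (us.map .cup ++ q)) :
        IsReducible N (us.map .cup ++ [.cup j, .cap i]) :=
      hr.of_smodEq (by simpa using hq.smodEq [])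
        (by rw [width_append, width_append]; exact hq.width_eq.symm)
    have cancel {k : ℕ} (hq : LocalRel m [.cup j, .cap i] k []) :=
      of_localRel hq (by simpa using (IsReduced.cups us).isReducible hus)
    have exchange {i' j' : ℕ} (hq : LocalRel m [.cup j, .cap i] 0 [.cap i', .cup j'])
        (hi' : i' + 2 ≤ m) (hj' : j' + 2 ≤ m) :=
      of_localRel hq <| by
        have hred := ih (valid_append.2 ⟨hus, valid_singleton.2 hi'⟩)
        simpa using hred.append_cup (j := j')
          (by rw [width_append]; exact (show j' ≤ m - 2 by omega))
    obtain rfl | rfl | rfl | hij | hij :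
      i = j ∨ i = j + 1 ∨ j = i + 1 ∨ i + 2 ≤ j ∨ j + 2 ≤ i := by omega
    · exact cancel (.circle i hj)
    · exact cancel (.cup_cap_succ j (by omega))
    · exact cancel (.cup_succ_cap i (by omega))
    · obtain ⟨j, rfl⟩ := Nat.exists_eq_add_of_le' ((Nat.le_add_left 2 i).trans hij)
      exact exchange (.cup_cap_left i j (by omega) hj) (by omega) hj
    · obtain ⟨i, rfl⟩ := Nat.exists_eq_add_of_le' ((Nat.le_add_left 2 j).trans hij)
      exact exchange (.cup_cap_right i j (by omega) (by omega)) (by omega) (by omega)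

theorem IsReduced.isReducible_append {s : Slice} (h : IsReduced w) (hv : Valid N (w ++ [s])) :
    IsReducible N (w ++ [s]) := by
  cases h with
  | cap_cons i w => exact (IsReduced.cap_cons i _).isReducible hv
  | cups us =>
    cases s with
    | cap i => exact isReducible_cups_cap hv
    | cup j => exact (IsReduced.cups us).append_cup.isReducible hv

theorem Valid.isReducible (h : Valid N w) : IsReducible N w := by
  induction w using List.reverseRecOn with
  | nil => exact (IsReduced.cups []).isReducible h
  | append_singleton w s ih =>
    obtain ⟨hw, hs⟩ := valid_append.1 h
    obtain ⟨c, r, hr, hv, hN, hc⟩ := ih hw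
    exact (hr.isReducible_append (valid_append.2 ⟨hv, hN ▸ hs⟩)).of_smodEq (smodEq_append hc _)
      (by rw [width_append, hN, width_append])

theorem width_cups (n : ℕ) (us : List ℕ) : width n (us.map .cup) = n + 2 * us.length := by
  induction us generalizing n with
  | nil => rfl
  | cons i us ih => rw [List.map_cons, width_cons, ih, List.length_cons, Slice.below]; omega

theorem IsReduced.eq_nil_or_cap_cons (h : IsReduced w) (hw : width N w = N) :
    w = [] ∨ ∃ i v, w = .cap i :: v := by
  cases h with
  | cap_cons i v => exact .inr ⟨i, v, rfl⟩
  | cups us =>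
    have : us.length = 0 := by have := width_cups N us; omega
    rw [List.length_eq_zero_iff.1 this]
    exact .inl rfl

/-- A stack starting with a cap can be rotated to a stack on fewer strands. -/
theorem annularBracket_succ (h : Valid N w) (hw : width N w = N) :
    annularBracket (N + 1) w = X * annularBracket N w := by
  induction N using Nat.strong_induction_on generalizing w with
  | _ N ih =>
    obtain ⟨c, r, hr, hv, hrN, hc⟩ := h.isReducible
    have hc' := SModEq.sub_mem.2 (skeinRelations_mono N.le_succ (SModEq.sub_mem.1 hc))
    rw [annularBracket_eq_of_smodEq hc, annularBracket_eq_of_smodEq hc', mul_smul_comm]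
    congr 1
    obtain rfl | ⟨i, v, rfl⟩ := hr.eq_nil_or_cap_cons (hrN.trans hw)
    · rw [annularBracket_nil, annularBracket_nil, pow_succ']
    · obtain ⟨hi, hv⟩ := hv
      obtain ⟨m, rfl⟩ := Nat.exists_eq_add_of_le' ((Nat.le_add_left 2 i).trans hi)
      replace hv : Valid m v := hv
      replace hrN : width m v = m + 2 := hrN.trans hw
      have hrot := annularBracket_rotate (n := m + 2) (u := [.cap i]) (v := v) hrN
      have hrot' := annularBracket_rotate (n := m + 2 + 1) (u := [.cap i]) (v := v)
        (show width (m + 1) v = m + 2 + 1 by rw [hv.width_add, hrN])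
      rw [List.singleton_append] at hrot hrot'
      rw [hrot, hrot']
      exact ih m (by omega) (valid_append.2 ⟨hv, valid_singleton.2 (hrN ▸ hi)⟩)
        (by rw [width_append, hrN]; rfl)

theorem Valid.cup_cons_smodEq (h : Valid N w) :
    diagram (.cup N :: w) ≡ diagram (w ++ [.cup (width N w)]) [SMOD skeinRelations N] := by
  induction w generalizing N with
  | nil => rfl
  | cons s w ih =>
    obtain ⟨hs, h⟩ := h
    have hrel : LocalRel N [.cup N, s] 0 [s, .cup (s.below N)] := by
      cases s with
      | cap i =>
        obtain ⟨m, rfl⟩ := Nat.exists_eq_add_of_le' ((Nat.le_add_left 2 i).trans hs)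
        exact .cup_cap_left i m (by simpa [Slice.Fits] using hs) le_rfl
      | cup i => exact .cup_cup i N hs le_rfl
    have hpast : diagram (.cup N :: s :: w) ≡ diagram (s :: .cup (s.below N) :: w)
        [SMOD skeinRelations N] := by
      simpa using hrel.smodEq (u := []) w
    refine hpast.trans ?_
    have := smodEq_diagram_mul (N := N) (u := [s]) (ih h)
    simpa only [← diagram_append, width_cons, width_nil, List.cons_append, List.nil_append]
      using this

/-- The cup is rotated to the top, where it can be pushed down past the other slices. -/
theorem annularBracket_cap_cup {i : ℕ} (h : Valid N w) (hw : width N w = N) :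
    annularBracket (N + 2) (w ++ [.cap i, .cup N]) = annularBracket N (w ++ [.cup N, .cap i]) := by
  have hcap : width (N + 2) (w ++ [.cap i]) = N := by
    rw [width_append, h.width_add, hw]; rfl
  have hrot := annularBracket_rotate (n := N + 2) (u := w ++ [.cap i]) (v := [.cup N])
    (by rw [width_append, hcap]; rfl)
  rw [hcap, List.append_assoc] at hrot
  have hpush := smodEq_mul_right h.cup_cons_smodEq (diagram [.cap i])
  rw [hw, ← diagram_append, ← diagram_append] at hpush
  simpa using hrot.trans (by simpa using annularTraceₗ_eq_of_smodEq hpush)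

theorem annularBracket_cap_cup_self (h : Valid N w) (hw : width N w = N) :
    annularBracket (N + 2) (w ++ [.cap N, .cup N]) = C d * annularBracket N w := by
  rw [annularBracket_cap_cup h hw]
  simpa using (LocalRel.circle (m := width N w) N hw.ge).annularBracket_eq []

theorem annularBracket_cap_cup_cap_cup (h : Valid (N + 1) w) (hw : width (N + 1) w = N + 1) :
    annularBracket (N + 3) (w ++ [.cap N, .cup N, .cap (N + 1), .cup (N + 1)]) =
      annularBracket (N + 1) w := by
  have hcap : width (N + 3) (w ++ [.cap N]) = N + 1 := by
    rw [width_append, h.width_add 2, hw]; rfl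
  have hmiddle := (LocalRel.cup_cap_succ (m := width (N + 3) (w ++ [.cap N])) N
    (by omega)).annularBracket_eq [.cup (N + 1)]
  have hlast := (LocalRel.cup_succ_cap (m := width (N + 1) w) N (by omega)).annularBracket_eq []
  simp only [pow_zero, C_1, one_mul, List.append_assoc, List.nil_append, List.append_nil,
    List.cons_append] at hmiddle hlast
  rw [hmiddle, annularBracket_cap_cup h hw, hlast]

end

noncomputable section

theorem A_ne_zero : A ≠ 0 := RatFunc.X_ne_zero

theorem A_pow_ne_one {n : ℕ} (hn : n ≠ 0) : A ^ n ≠ 1 := fun h => by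
  have hX : algebraMap ℚ[X] K (X ^ n) = algebraMap ℚ[X] K 1 := by
    rw [map_pow, RatFunc.algebraMap_X, map_one]; exact h
  exact hn (by simpa using congrArg natDegree (RatFunc.algebraMap_injective ℚ hX))

theorem A_pow_sub_inv_ne_zero {n : ℕ} (hn : n ≠ 0) : A ^ n - (A ^ n)⁻¹ ≠ 0 := by
  intro h
  refine A_pow_ne_one (n := n + n) (by omega) ?_
  rw [pow_add]
  nth_rewrite 1 [sub_eq_zero.1 h]
  exact inv_mul_cancel₀ (pow_ne_zero n A_ne_zero)

theorem A_sq_mul_d : A ^ 2 * d = -A ^ 4 - 1 := by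
  have := A_ne_zero
  rw [d]
  field_simp

theorem d_ne_zero : d ≠ 0 := by
  intro h
  have hA := A_sq_mul_d
  rw [h, mul_zero] at hA
  exact A_pow_ne_one (n := 8) (by norm_num) (by linear_combination (A ^ 4 - 1) * hA)

/-- The quantum integer `1 + q + ⋯ + q^(n-1)` with `q = A⁴`. -/
def quantumInt (n : ℕ) : K := ∑ k ∈ Finset.range n, (A ^ 4) ^ k

@[simp] theorem quantumInt_zero : quantumInt 0 = 0 := by simp [quantumInt]

@[simp] theorem quantumInt_one : quantumInt 1 = 1 := by simp [quantumInt]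

theorem quantumInt_succ (n : ℕ) : quantumInt (n + 1) = 1 + A ^ 4 * quantumInt n := by
  rw [quantumInt, geom_sum_succ, add_comm]; rfl

theorem quantumInt_ne_zero {n : ℕ} (hn : n ≠ 0) : quantumInt n ≠ 0 := by
  intro h
  have hgeom : quantumInt n * (A ^ 4 - 1) = (A ^ 4) ^ n - 1 := geom_sum_mul _ _
  rw [h, zero_mul, ← pow_mul, eq_comm, sub_eq_zero] at hgeom
  exact A_pow_ne_one (by omega) hgeom

theorem quantumInt_add_two (n : ℕ) :
    quantumInt (n + 2) = -A ^ 2 * (d * quantumInt (n + 1) + A ^ 2 * quantumInt n) := by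
  rw [quantumInt_succ (n + 1), quantumInt_succ n]
  linear_combination (1 + A ^ 4 * quantumInt n) * A_sq_mul_d

@[simp] theorem quantumFactorial_zero : quantumFactorial 0 = 1 := by simp [quantumFactorial]

theorem quantumFactorial_succ (n : ℕ) :
    quantumFactorial (n + 1) = quantumFactorial n * quantumInt (n + 1) :=
  Finset.prod_range_succ _ _

theorem quantumFactorial_ne_zero (n : ℕ) : quantumFactorial n ≠ 0 :=
  Finset.prod_ne_zero_iff.2 fun m _ => quantumInt_ne_zero m.succ_ne_zero

/-! ### Symmetrizers in Temperley-Lieb algebras -/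

section TemperleyLieb

variable {R : Type*} [Ring R] [Algebra K R]

/-- The elements `e 0, …, e (N - 2)` satisfy the relations of the generators of the Temperley-Lieb
algebra on `N` strands. -/
structure IsTemperleyLieb (e : ℕ → R) (N : ℕ) : Prop where
  mul_self : ∀ i, i + 2 ≤ N → e i * e i = d • e i
  mul_succ_mul : ∀ i, i + 3 ≤ N → e i * e (i + 1) * e i = e i
  succ_mul_succ : ∀ i, i + 3 ≤ N → e (i + 1) * e i * e (i + 1) = e (i + 1)
  commute : ∀ i j, i + 2 ≤ j → j + 2 ≤ N → Commute (e i) (e j)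

/-- The positive crossing `A + A⁻¹ e i`, multiplied by `A³`. -/
def crossing (e : ℕ → R) (i : ℕ) : R := A ^ 4 • (1 : R) + A ^ 2 • e i

/-- The sum of the products `crossing e (n - 1) * ⋯ * crossing e (n - k)` for `k ≤ n`. These are the
positive braids of the minimal representatives of the cosets of `𝔖ₙ` in `𝔖ₙ₊₁`. -/
def cosetSum (e : ℕ → R) : ℕ → R
  | 0 => 1
  | n + 1 => 1 + crossing e n * cosetSum e n

/-- The sum of the minimal positive braids of the permutations of `n` strands, factored along the
chain `𝔖₁ ⊆ ⋯ ⊆ 𝔖ₙ`. -/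
def symmetrizer (e : ℕ → R) : ℕ → R
  | 0 => 1
  | n + 1 => symmetrizer e n * cosetSum e n

variable {e : ℕ → R} {n N : ℕ} {x : R}

namespace IsTemperleyLieb

theorem crossing_mul_self (h : IsTemperleyLieb e N) {i : ℕ} (hi : i + 2 ≤ N) :
    crossing e i * e i = -e i := by
  rw [crossing, add_mul, smul_mul_assoc, smul_mul_assoc, one_mul, h.mul_self i hi, smul_smul,
    ← add_smul, A_sq_mul_d, show A ^ 4 + (-A ^ 4 - 1) = -1 by ring, neg_one_smul]

theorem crossing_succ_mul_crossing_mul (h : IsTemperleyLieb e N) {i : ℕ} (hi : i + 3 ≤ N) :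
    crossing e (i + 1) * (crossing e i * e (i + 1)) = A ^ 6 • (e i * e (i + 1)) := by
  have hleft : crossing e i * e (i + 1) = A ^ 4 • e (i + 1) + A ^ 2 • (e i * e (i + 1)) := by
    rw [crossing, add_mul, smul_mul_assoc, smul_mul_assoc, one_mul]
  have hright : crossing e (i + 1) * (e i * e (i + 1)) =
      A ^ 4 • (e i * e (i + 1)) + A ^ 2 • e (i + 1) := by
    rw [crossing, add_mul, smul_mul_assoc, smul_mul_assoc, one_mul, ← mul_assoc,
      h.succ_mul_succ i hi]
  rw [hleft, mul_add, mul_smul_comm, mul_smul_comm, h.crossing_mul_self (by omega), hright,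
    smul_add, smul_smul, smul_smul, ← pow_add, ← pow_add, smul_neg]
  exact neg_add_cancel_comm_assoc _ _

theorem commute_crossing (h : IsTemperleyLieb e N) {i j : ℕ} (hij : i + 2 ≤ j) (hj : j + 2 ≤ N) :
    Commute (e i) (crossing e j) :=
  ((Commute.one_right _).smul_right _).add_right ((h.commute i j hij hj).smul_right _)

theorem crossing_commute (h : IsTemperleyLieb e N) {i j : ℕ} (hij : i + 2 ≤ j) (hj : j + 2 ≤ N) :
    Commute (crossing e i) (e j) :=
  ((Commute.one_left _).smul_left _).add_left ((h.commute i j hij hj).smul_left _)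

theorem cosetSum_commute (h : IsTemperleyLieb e N) {j : ℕ} (hn : n + 1 ≤ j) (hj : j + 2 ≤ N) :
    Commute (cosetSum e n) (e j) := by
  induction n with
  | zero => exact Commute.one_left _
  | succ n ih =>
    exact (Commute.one_left _).add_left
      ((h.crossing_commute (by omega) hj).mul_left (ih (by omega)))

theorem cosetSum_add_two_mul (h : IsTemperleyLieb e N) (hn : n + 3 ≤ N) :
    cosetSum e (n + 2) * e (n + 1) = A ^ 6 • (e n * e (n + 1) * cosetSum e n) := by
  calc cosetSum e (n + 2) * e (n + 1)
    _ = e (n + 1) + crossing e (n + 1) * e (n + 1) +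
          crossing e (n + 1) * (crossing e n * (cosetSum e n * e (n + 1))) := by
        simp only [cosetSum]; noncomm_ring
    _ = crossing e (n + 1) * (crossing e n * e (n + 1)) * cosetSum e n := by
        rw [h.crossing_mul_self (by omega), add_neg_cancel, zero_add,
          (h.cosetSum_commute le_rfl (by omega)).eq]
        simp only [mul_assoc]
    _ = A ^ 6 • (e n * e (n + 1) * cosetSum e n) := by
        rw [h.crossing_succ_mul_crossing_mul hn, smul_mul_assoc]

theorem mul_cosetSum_mul_eq_zero (h : IsTemperleyLieb e N)
    (hx : ∀ k, k + 2 ≤ n → x * e k = 0) {i : ℕ} (hi : i + 1 ≤ n) (hn : n + 1 ≤ N) :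
    x * (cosetSum e n * e i) = 0 := by
  induction n generalizing x i with
  | zero => omega
  | succ n ih =>
    obtain hi | rfl : i + 1 ≤ n ∨ i = n := by omega
    · have hx' : ∀ k, k + 2 ≤ n → x * crossing e n * e k = 0 := fun k hk => by
        rw [mul_assoc, ← (h.commute_crossing hk hn).eq, ← mul_assoc, hx k (by omega), zero_mul]
      rw [cosetSum, add_mul, mul_add, one_mul, hx i (by omega), zero_add, mul_assoc, ← mul_assoc x]
      exact ih hx' hi (by omega)
    · cases i with
      | zero =>
        rw [cosetSum, cosetSum, mul_one, add_mul, one_mul, h.crossing_mul_self hn,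
          add_neg_cancel, mul_zero]
      | succ n =>
        rw [h.cosetSum_add_two_mul hn, mul_smul_comm, mul_assoc (e n), ← mul_assoc x,
          hx n le_rfl, zero_mul, smul_zero]

theorem symmetrizer_mul (h : IsTemperleyLieb e N) {i : ℕ} (hi : i + 2 ≤ n) (hn : n ≤ N) :
    symmetrizer e n * e i = 0 := by
  induction n generalizing i with
  | zero => omega
  | succ n ih =>
    rw [symmetrizer, mul_assoc]
    exact h.mul_cosetSum_mul_eq_zero (fun k hk => ih hk (by omega)) (by omega) hn

theorem op (h : IsTemperleyLieb e N) : IsTemperleyLieb (fun i => MulOpposite.op (e i)) N where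
  mul_self i hi := by rw [← MulOpposite.op_mul, h.mul_self i hi, MulOpposite.op_smul]
  mul_succ_mul i hi := by
    rw [← MulOpposite.op_mul, ← MulOpposite.op_mul, ← mul_assoc, h.mul_succ_mul i hi]
  succ_mul_succ i hi := by
    rw [← MulOpposite.op_mul, ← MulOpposite.op_mul, ← mul_assoc, h.succ_mul_succ i hi]
  commute i j hij hj := (h.commute i j hij hj).op

end IsTemperleyLieb

theorem cosetSum_mul_of_forall (hx : ∀ i, i + 2 ≤ n → e i * x = 0) {j : ℕ} (hj : j + 1 ≤ n) :
    cosetSum e j * x = quantumInt (j + 1) • x := by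
  induction j with
  | zero => rw [cosetSum, one_mul, quantumInt_one, one_smul]
  | succ j ih =>
    rw [cosetSum, add_mul, one_mul, mul_assoc, ih (by omega), mul_smul_comm, crossing, add_mul,
      smul_mul_assoc, smul_mul_assoc, hx j (by omega), one_mul, smul_zero, add_zero, smul_smul,
      quantumInt_succ (j + 1), add_smul, one_smul, mul_comm]

theorem symmetrizer_mul_of_forall (hx : ∀ i, i + 2 ≤ n → e i * x = 0) {m : ℕ} (hm : m ≤ n) :
    symmetrizer e m * x = quantumFactorial m • x := by
  induction m with
  | zero => rw [symmetrizer, one_mul, quantumFactorial_zero, one_smul]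
  | succ m ih =>
    rw [symmetrizer, mul_assoc, cosetSum_mul_of_forall hx hm, mul_smul_comm, ih (by omega),
      smul_smul, quantumFactorial_succ, mul_comm]

theorem mul_cosetSum_of_forall (hx : ∀ i, i + 2 ≤ n → x * e i = 0) {j : ℕ} (hj : j + 1 ≤ n) :
    x * cosetSum e j = quantumInt (j + 1) • x := by
  induction j with
  | zero => rw [cosetSum, mul_one, quantumInt_one, one_smul]
  | succ j ih =>
    have hcrossing : x * crossing e j = A ^ 4 • x := by
      rw [crossing, mul_add, mul_smul_comm, mul_smul_comm, hx j (by omega), smul_zero, add_zero,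
        mul_one]
    rw [cosetSum, mul_add, mul_one, ← mul_assoc, hcrossing, smul_mul_assoc, ih (by omega),
      smul_smul, quantumInt_succ (j + 1), add_smul, one_smul]

/-- The mirror image of the symmetrizer is annihilated from the left, and multiplying the two in
either way shows that they agree. -/
theorem IsTemperleyLieb.mul_symmetrizer (h : IsTemperleyLieb e N) {i : ℕ} (hi : i + 2 ≤ n)
    (hn : n ≤ N) : e i * symmetrizer e n = 0 := by
  set e' : ℕ → Rᵐᵒᵖ := fun i => MulOpposite.op (e i)
  set mirror : R := MulOpposite.unop (symmetrizer e' n)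
  have hmirror : ∀ k, k + 2 ≤ n → e k * mirror = 0 := fun k hk =>
    congrArg MulOpposite.unop (h.op.symmetrizer_mul hk hn)
  have hmul : symmetrizer e n * mirror = quantumFactorial n • mirror :=
    symmetrizer_mul_of_forall hmirror le_rfl
  have hmul' : symmetrizer e n * mirror = quantumFactorial n • symmetrizer e n := by
    have := symmetrizer_mul_of_forall (e := e') (n := n) (x := MulOpposite.op (symmetrizer e n))
      (fun k hk => by rw [← MulOpposite.op_mul, h.symmetrizer_mul hk hn, MulOpposite.op_zero])
      le_rfl
    exact congrArg MulOpposite.unop this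
  have heq : symmetrizer e n = mirror :=
    smul_right_injective R (quantumFactorial_ne_zero n) (hmul'.symm.trans hmul)
  rw [heq]
  exact hmirror i hi

theorem lehmer_lt (π : Equiv.Perm (Fin n)) (j : Fin n) : lehmer π j < j + 1 := by
  have : lehmer π j ≤ (Finset.Iio j).card :=
    Finset.card_le_card fun i hi => Finset.mem_Iio.2 (Finset.mem_filter.1 hi).2.1
  rw [Fin.card_Iio] at this
  omega

theorem lehmer_injective (n : ℕ) :
    Function.Injective (lehmer : Equiv.Perm (Fin n) → Fin n → ℕ) := by
  intro π ρ h
  have hword : permWord π = permWord ρ := by rw [permWord, permWord, h]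
  ext j
  rw [← prod_permWord, ← prod_permWord, hword]

theorem image_lehmer (n : ℕ) :
    Finset.univ.image (lehmer : Equiv.Perm (Fin n) → Fin n → ℕ) =
      Fintype.piFinset fun j : Fin n => Finset.range (j + 1) := by
  refine Finset.eq_of_subset_of_card_le ?_ ?_
  · intro c hc
    obtain ⟨π, -, rfl⟩ := Finset.mem_image.1 hc
    exact Fintype.mem_piFinset.2 fun j => Finset.mem_range.2 (lehmer_lt π j)
  · rw [Finset.card_image_of_injective _ (lehmer_injective n), Fintype.card_piFinset,
      Finset.card_univ, Fintype.card_perm, Fintype.card_fin]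
    simp only [Finset.card_range]
    rw [Fin.prod_univ_eq_prod_range (fun j => j + 1), Finset.prod_range_add_one_eq_factorial]

theorem cosetSum_eq_sum (e : ℕ → R) (n : ℕ) :
    cosetSum e n = ∑ k ∈ Finset.range (n + 1),
      ((List.range k).map fun t => crossing e (n - 1 - t)).prod := by
  induction n with
  | zero => simp [cosetSum]
  | succ n ih =>
    rw [Finset.sum_range_succ', cosetSum, ih, Finset.mul_sum, add_comm]
    congr 1
    refine Finset.sum_congr rfl fun k _ => ?_
    rw [List.range_succ_eq_map, List.map_cons, List.prod_cons, List.map_map]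
    congr 3
    funext t
    simp only [Function.comp_apply]
    congr 1
    omega

theorem symmetrizer_eq_prod (e : ℕ → R) (n : ℕ) :
    symmetrizer e n = (List.ofFn fun j : Fin n => cosetSum e j).prod := by
  induction n with
  | zero => simp [symmetrizer]
  | succ n ih =>
    rw [List.ofFn_succ', List.concat_eq_append, List.prod_append, List.prod_singleton, symmetrizer,
      ih]
    rfl

theorem sum_perm_eq_symmetrizer (e : ℕ → R) (n : ℕ) :
    ∑ π : Equiv.Perm (Fin n), ((permWord π).map (crossing e)).prod = symmetrizer e n := by
  simp only [symmetrizer_eq_prod, cosetSum_eq_sum]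
  simp only [← MultilinearMap.mkPiAlgebraFin_apply (R := K), MultilinearMap.map_sum_finset]
  rw [← image_lehmer, Finset.sum_image (lehmer_injective n).injOn]
  refine Finset.sum_congr rfl fun π _ => ?_
  rw [permWord, List.map_flatMap, List.flatMap_def, List.prod_flatten, List.map_map,
    MultilinearMap.mkPiAlgebraFin_apply, List.ofFn_eq_map]
  simp only [Function.comp_def, List.map_map]

end TemperleyLieb

theorem A_cube_smul_sigma (i : ℕ) : A ^ 3 • sigma i = crossing e i := by
  rw [sigma, smul_add, smul_smul, smul_smul, crossing, show A ^ 3 * A = A ^ 4 by ring,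
    show A ^ 3 * A⁻¹ = A ^ 2 by have := A_ne_zero; field_simp]

theorem jonesWenzl_eq (s n : ℕ) :
    jonesWenzl s n = (quantumFactorial n)⁻¹ • symmetrizer (fun i => e (s + i)) n := by
  rw [jonesWenzl, ← sum_perm_eq_symmetrizer]
  congr 1
  refine Finset.sum_congr rfl fun π _ => ?_
  rw [permBraid]
  induction permWord π with
  | nil => simp
  | cons i l ih =>
    rw [List.length_cons, List.map_cons, List.map_cons, List.prod_cons, List.prod_cons, ← ih,
      mul_smul_comm, pow_succ, mul_smul, ← smul_mul_assoc, A_cube_smul_sigma]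
    rfl

end

noncomputable section

variable {N n k : ℕ} {w : List Slice} {x y z : Tangles}

theorem e_mul_diagram (i : ℕ) (w : List Slice) :
    e i * diagram w = diagram (.cap i :: .cup i :: w) := by
  rw [e, ← diagram_append]
  rfl

theorem e_mul_e (i j : ℕ) : e i * e j = diagram [.cap i, .cup i, .cap j, .cup j] :=
  e_mul_diagram _ _

/-- Left multiplication by `e i` on tangles modulo the skein relations. It is zero unless there are
strands `i` and `i + 1`, since otherwise `e i` need not preserve the relations. -/
def eAct (N i : ℕ) : Module.End K (Tangles ⧸ skeinRelations N) :=
  if h : i + 2 ≤ N then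
    (skeinRelations N).mapQ (skeinRelations N) (LinearMap.mulLeft K (e i)) fun x hx => by
      have hwidth : width N [.cap i, .cup i] = N := Nat.sub_add_cancel (by omega)
      exact diagram_mul_mem_skeinRelations (by rwa [hwidth])
  else 0

/-- The endomorphism `r` is left multiplication by `x`. -/
def Implements (N : ℕ) (r : Module.End K (Tangles ⧸ skeinRelations N)) (x : Tangles) : Prop :=
  ∀ y, r (Submodule.Quotient.mk y) = Submodule.Quotient.mk (x * y)

theorem implements_eAct {i : ℕ} (h : i + 2 ≤ N) : Implements N (eAct N i) (e i) := by
  intro y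
  rw [eAct, dif_pos h]
  rfl

namespace Implements

variable {r s : Module.End K (Tangles ⧸ skeinRelations N)}

theorem one : Implements N 1 1 := fun y => by rw [one_mul]; rfl

theorem mul (h : Implements N r x) (h' : Implements N s y) : Implements N (r * s) (x * y) :=
  fun z => by rw [Module.End.mul_apply, h', h, mul_assoc]

theorem add (h : Implements N r x) (h' : Implements N s y) : Implements N (r + s) (x + y) :=
  fun z => by rw [LinearMap.add_apply, h, h', add_mul, Submodule.Quotient.mk_add]

theorem smul (h : Implements N r x) (c : K) : Implements N (c • r) (c • x) :=
  fun z => by rw [LinearMap.smul_apply, h, smul_mul_assoc, Submodule.Quotient.mk_smul]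

theorem crossing {i : ℕ} (h : i + 2 ≤ N) : Implements N (crossing (eAct N) i) (crossing e i) :=
  (one.smul _).add ((implements_eAct h).smul _)

theorem cosetSum (h : n + 1 ≤ N) : Implements N (cosetSum (eAct N) n) (cosetSum e n) := by
  induction n with
  | zero => exact one
  | succ n ih => exact one.add ((crossing h).mul (ih (by omega)))

theorem symmetrizer (h : n ≤ N) : Implements N (symmetrizer (eAct N) n) (symmetrizer e n) := by
  induction n with
  | zero => exact one
  | succ n ih => exact (ih (by omega)).mul (cosetSum h)

theorem mul_smodEq (h : Implements N r x) (h' : Implements N s y) (hrs : r = s) (z : Tangles) :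
    x * z ≡ y * z [SMOD skeinRelations N] := by
  rw [SModEq, ← h, ← h', hrs]

theorem eq_of_forall_diagram (h : Implements N r x) (h' : Implements N s y)
    (hxy : ∀ w, x * diagram w ≡ y * diagram w [SMOD skeinRelations N]) : r = s :=
  Submodule.linearMap_qext _ <| LinearMap.ext_on_range span_range_diagram fun w =>
    ((h _).trans (hxy w)).trans (h' _).symm

end Implements

theorem e_mul_cap_smodEq {i : ℕ} (hi : i + 2 ≤ N) (w : List Slice) :
    e i * diagram (.cap i :: w) ≡ d • diagram (.cap i :: w) [SMOD skeinRelations N] := by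
  have hcircle := (LocalRel.circle (m := N - 2) i (by omega)).smodEq (N := N) (u := [.cap i]) w
  rw [pow_one] at hcircle
  rw [e_mul_diagram]
  exact hcircle

theorem eAct_mul_self {i : ℕ} (hi : i + 2 ≤ N) : eAct N i * eAct N i = d • eAct N i := by
  refine ((implements_eAct hi).mul (implements_eAct hi)).eq_of_forall_diagram
    ((implements_eAct hi).smul d) fun w => ?_
  rw [mul_assoc, smul_mul_assoc, e_mul_diagram i w]
  exact e_mul_cap_smodEq hi _

theorem eAct_mul_eAct_mul_eAct {i j : ℕ} (hi : i + 2 ≤ N) (hj : j + 2 ≤ N)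
    (hij : LocalRel (N - 2) [.cup i, .cap j] 0 []) (hji : LocalRel (N - 2) [.cup j, .cap i] 0 []) :
    eAct N i * eAct N j * eAct N i = eAct N i := by
  refine (((implements_eAct hi).mul (implements_eAct hj)).mul
    (implements_eAct hi)).eq_of_forall_diagram (implements_eAct hi) fun w => ?_
  rw [mul_assoc, mul_assoc, e_mul_diagram, e_mul_diagram, e_mul_diagram]
  have hfirst := hij.smodEq (N := N) (u := [.cap i]) ([.cup j, .cap i] ++ .cup i :: w)
  have hsecond := hji.smodEq (N := N) (u := [.cap i]) (.cup i :: w)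
  simp only [pow_zero, one_smul] at hfirst hsecond
  exact hfirst.trans hsecond

theorem eAct_commute {i j : ℕ} (hij : i ≤ j) (hj : j + 4 ≤ N) :
    Commute (eAct N i) (eAct N (j + 2)) := by
  have hi : i + 2 ≤ N := by omega
  have hj' : j + 2 + 2 ≤ N := hj
  refine ((implements_eAct hi).mul (implements_eAct hj')).eq_of_forall_diagram
    ((implements_eAct hj').mul (implements_eAct hi)) fun w => ?_
  rw [mul_assoc, mul_assoc, e_mul_diagram, e_mul_diagram, e_mul_diagram, e_mul_diagram]
  have hcupcap := (LocalRel.cup_cap_right (m := N - 2) j i hij (by omega)).smodEq (N := N)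
    (u := [.cap i]) (.cup (j + 2) :: w)
  have hcupcap' := (LocalRel.cup_cap_left (m := N - 2) i j hij (by omega)).smodEq (N := N)
    (u := [.cap (j + 2)]) (.cup i :: w)
  have hcaps := (LocalRel.cap_cap (m := N) i j hij hj).smodEq (N := N) (u := [])
    (.cup j :: .cup i :: w)
  have hcups := (LocalRel.cup_cup (m := N - 2 - 2) i j hij (by omega)).smodEq (N := N)
    (u := [.cap i, .cap j]) w
  simp only [pow_zero, one_smul] at hcupcap hcupcap' hcaps hcups
  exact hcupcap.trans (hcupcap'.trans (hcaps.trans hcups)).symm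

theorem isTemperleyLieb_eAct (N : ℕ) : IsTemperleyLieb (eAct N) N where
  mul_self _ hi := eAct_mul_self hi
  mul_succ_mul i hi := eAct_mul_eAct_mul_eAct (by omega) hi (.cup_cap_succ i (by omega))
    (.cup_succ_cap i (by omega))
  succ_mul_succ i hi := eAct_mul_eAct_mul_eAct hi (by omega) (.cup_succ_cap i (by omega))
    (.cup_cap_succ i (by omega))
  commute i j hij hj := by
    obtain ⟨l, rfl⟩ := Nat.exists_eq_add_of_le' (show 2 ≤ j by omega)
    exact eAct_commute (by omega) hj

/-- The span of the valid stacks with `N` points at the top and at the bottom. -/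
def closedSpan (N : ℕ) : Submodule K Tangles :=
  Submodule.span K (diagram '' {w | Valid N w ∧ width N w = N})

theorem diagram_mem_closedSpan (h : Valid N w) (hw : width N w = N) :
    diagram w ∈ closedSpan N :=
  Submodule.subset_span ⟨w, ⟨h, hw⟩, rfl⟩

theorem closedSpan_le {p : Submodule K Tangles}
    (h : ∀ w, Valid N w → width N w = N → diagram w ∈ p) : closedSpan N ≤ p :=
  Submodule.span_le.2 <| Set.image_subset_iff.2 fun w hw => h w hw.1 hw.2

theorem eq_of_mem_closedSpan {M : Type*} [AddCommMonoid M] [Module K M] {f g : Tangles →ₗ[K] M}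
    (h : ∀ w, Valid N w → width N w = N → f (diagram w) = g (diagram w))
    (hx : x ∈ closedSpan N) : f x = g x :=
  closedSpan_le (p := LinearMap.eqLocus f g) h hx

theorem diagram_mul_mul_diagram_mem_closedSpan {M : ℕ} {s t : List Slice} (hs : Valid N s)
    (hsM : width N s = M) (ht : Valid M t) (htN : width M t = N) (hx : x ∈ closedSpan M) :
    diagram s * x * diagram t ∈ closedSpan N := by
  refine closedSpan_le (p := (closedSpan N).comap
    (LinearMap.mulRight K (diagram t) ∘ₗ LinearMap.mulLeft K (diagram s))) (fun w h hw => ?_) hx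
  simp only [Submodule.mem_comap, LinearMap.comp_apply, LinearMap.mulLeft_apply,
    LinearMap.mulRight_apply, ← diagram_append]
  refine diagram_mem_closedSpan ?_ ?_
  · rw [valid_append, valid_append, width_append, hsM, hw]
    exact ⟨⟨hs, h⟩, ht⟩
  · rw [width_append, width_append, hsM, hw, htN]

theorem one_mem_closedSpan (N : ℕ) : (1 : Tangles) ∈ closedSpan N := by
  rw [← diagram_nil]
  exact diagram_mem_closedSpan trivial rfl

theorem mul_mem_closedSpan (hx : x ∈ closedSpan N) (hy : y ∈ closedSpan N) :
    x * y ∈ closedSpan N := by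
  refine closedSpan_le (p := (closedSpan N).comap (LinearMap.mulRight K y)) (fun w h hw => ?_) hx
  simpa only [diagram_nil, mul_one, Submodule.mem_comap, LinearMap.mulRight_apply] using
    diagram_mul_mul_diagram_mem_closedSpan h hw (t := []) trivial rfl hy

theorem e_mem_closedSpan {i : ℕ} (h : i + 2 ≤ N) : e i ∈ closedSpan N :=
  diagram_mem_closedSpan ⟨h, Nat.le_sub_of_add_le h, trivial⟩ (Nat.sub_add_cancel (by omega))

theorem cosetSum_mem_closedSpan {s : ℕ} (h : s + n + 1 ≤ N) :
    cosetSum (fun i => e (s + i)) n ∈ closedSpan N := by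
  induction n with
  | zero => exact one_mem_closedSpan N
  | succ n ih =>
    refine add_mem (one_mem_closedSpan N) (mul_mem_closedSpan (add_mem ?_ ?_) (ih (by omega)))
    · exact Submodule.smul_mem _ _ (one_mem_closedSpan N)
    · exact Submodule.smul_mem _ _ (e_mem_closedSpan (by omega))

theorem symmetrizer_mem_closedSpan {s : ℕ} (h : s + n ≤ N) :
    symmetrizer (fun i => e (s + i)) n ∈ closedSpan N := by
  induction n with
  | zero => exact one_mem_closedSpan N
  | succ n ih => exact mul_mem_closedSpan (ih (by omega)) (cosetSum_mem_closedSpan (by omega))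

theorem jonesWenzl_mem_closedSpan {s : ℕ} (h : s + n ≤ N) : jonesWenzl s n ∈ closedSpan N := by
  rw [jonesWenzl_eq]
  exact Submodule.smul_mem _ _ (symmetrizer_mem_closedSpan h)

theorem cosetSum_e_mem_closedSpan (h : n + 1 ≤ N) : cosetSum e n ∈ closedSpan N := by
  simpa only [zero_add] using cosetSum_mem_closedSpan (s := 0) (n := n) (N := N) (by omega)

theorem symmetrizer_e_mem_closedSpan (h : n ≤ N) : symmetrizer e n ∈ closedSpan N := by
  simpa only [zero_add] using symmetrizer_mem_closedSpan (s := 0) (n := n) (N := N) (by omega)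

theorem annularTraceₗ_mul_comm (hx : x ∈ closedSpan N) (hy : y ∈ closedSpan N) :
    annularTraceₗ N (x * y) = annularTraceₗ N (y * x) := by
  refine eq_of_mem_closedSpan (f := annularTraceₗ N ∘ₗ LinearMap.mulRight K y)
    (g := annularTraceₗ N ∘ₗ LinearMap.mulLeft K y) (fun w _ hw => ?_) hx
  refine eq_of_mem_closedSpan (f := annularTraceₗ N ∘ₗ LinearMap.mulLeft K (diagram w))
    (g := annularTraceₗ N ∘ₗ LinearMap.mulRight K (diagram w)) (fun w' _ hw' => ?_) hy
  simp only [LinearMap.comp_apply, LinearMap.mulLeft_apply, LinearMap.mulRight_apply,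
    ← diagram_append, annularTraceₗ_diagram]
  rw [annularBracket_rotate (by rw [width_append, hw, hw']), hw]

theorem annularTraceₗ_succ (hx : x ∈ closedSpan n) :
    annularTraceₗ (n + 1) x = X * annularTraceₗ n x := by
  refine eq_of_mem_closedSpan (f := annularTraceₗ (n + 1))
    (g := LinearMap.mulLeft K X ∘ₗ annularTraceₗ n) (fun w h hw => ?_) hx
  simp only [LinearMap.comp_apply, LinearMap.mulLeft_apply, annularTraceₗ_diagram,
    annularBracket_succ h hw]

theorem annularTraceₗ_mul_e (hx : x ∈ closedSpan k) :
    annularTraceₗ (k + 2) (x * e k) = C d * annularTraceₗ k x := by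
  refine eq_of_mem_closedSpan (f := annularTraceₗ (k + 2) ∘ₗ LinearMap.mulRight K (e k))
    (g := LinearMap.mulLeft K (C d) ∘ₗ annularTraceₗ k) (fun w h hw => ?_) hx
  simp only [LinearMap.comp_apply, LinearMap.mulLeft_apply, LinearMap.mulRight_apply, e,
    ← diagram_append, annularTraceₗ_diagram, annularBracket_cap_cup_self h hw]

theorem annularTraceₗ_mul_e_mul_e (hx : x ∈ closedSpan (k + 1)) :
    annularTraceₗ (k + 3) (x * (e k * e (k + 1))) = annularTraceₗ (k + 1) x := by
  refine eq_of_mem_closedSpan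
    (f := annularTraceₗ (k + 3) ∘ₗ LinearMap.mulRight K (e k * e (k + 1)))
    (g := annularTraceₗ (k + 1)) (fun w h hw => ?_) hx
  simp only [LinearMap.comp_apply, LinearMap.mulRight_apply, e_mul_e, ← diagram_append,
    annularTraceₗ_diagram, annularBracket_cap_cup_cap_cup h hw]

theorem symmetrizer_mul_cosetSum_mul_smodEq {j : ℕ} (hn : n ≤ N) (hj : j + 1 ≤ n) (z : Tangles) :
    symmetrizer e n * cosetSum e j * z ≡ (quantumInt (j + 1) • symmetrizer e n) * z
      [SMOD skeinRelations N] :=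
  ((Implements.symmetrizer hn).mul (Implements.cosetSum (hj.trans hn))).mul_smodEq
    ((Implements.symmetrizer hn).smul _) (mul_cosetSum_of_forall
      (fun _ hi => (isTemperleyLieb_eAct N).symmetrizer_mul hi hn) hj) z

theorem cosetSum_mul_symmetrizer_mul_smodEq {j : ℕ} (hn : n ≤ N) (hj : j + 1 ≤ n) (z : Tangles) :
    cosetSum e j * symmetrizer e n * z ≡ (quantumInt (j + 1) • symmetrizer e n) * z
      [SMOD skeinRelations N] :=
  ((Implements.cosetSum (hj.trans hn)).mul (Implements.symmetrizer hn)).mul_smodEq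
    ((Implements.symmetrizer hn).smul _) (cosetSum_mul_of_forall
      (fun _ hi => (isTemperleyLieb_eAct N).mul_symmetrizer hi hn) hj) z

theorem annularTraceₗ_symmetrizer_mul_cosetSum_mul {j : ℕ} (hn : n ≤ N) (hj : j + 1 ≤ n)
    (z : Tangles) : annularTraceₗ N (symmetrizer e n * cosetSum e j * z) =
      C (quantumInt (j + 1)) * annularTraceₗ N (symmetrizer e n * z) := by
  rw [annularTraceₗ_eq_of_smodEq (symmetrizer_mul_cosetSum_mul_smodEq hn hj z), smul_mul_assoc,
    map_smul, smul_eq_C_mul]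

theorem annularTraceₗ_symmetrizer_mul_mul_cosetSum {j : ℕ} (hn : n ≤ N) (hj : j + 1 ≤ n)
    (hz : z ∈ closedSpan N) :
    annularTraceₗ N (symmetrizer e n * z * cosetSum e j) =
      C (quantumInt (j + 1)) * annularTraceₗ N (symmetrizer e n * z) := by
  rw [annularTraceₗ_mul_comm (mul_mem_closedSpan (symmetrizer_e_mem_closedSpan hn) hz)
      (cosetSum_e_mem_closedSpan (hj.trans hn)), ← mul_assoc,
    annularTraceₗ_eq_of_smodEq (cosetSum_mul_symmetrizer_mul_smodEq hn hj z), smul_mul_assoc,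
    map_smul, smul_eq_C_mul]

theorem symmetrizer_add_two_mul (k : ℕ) (z : Tangles) :
    symmetrizer e (k + 2) * z = symmetrizer e (k + 1) * z +
      (A ^ 4 • (symmetrizer e (k + 1) * cosetSum e k * z) +
        A ^ 2 • (symmetrizer e (k + 1) * e k * cosetSum e k * z)) := by
  have hcoset : symmetrizer e (k + 2) =
    symmetrizer e (k + 1) * (1 + crossing e k * cosetSum e k) := rfl
  rw [hcoset, crossing]
  simp only [mul_add, add_mul, mul_smul_comm, smul_mul_assoc, mul_one, one_mul, mul_assoc]

/-- The coset sum commutes with `e (k + 1)`, and moves around the annulus into the symmetrizer. -/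
theorem annularTraceₗ_symmetrizer_mul_e_mul_cosetSum_mul_e (k : ℕ) :
    annularTraceₗ (k + 3) (symmetrizer e (k + 1) * e k * cosetSum e k * e (k + 1)) =
      C (quantumInt (k + 1)) * annularTraceₗ (k + 1) (symmetrizer e (k + 1)) := by
  have hS := Implements.symmetrizer (N := k + 3) (n := k + 1) (by omega)
  have hQ := Implements.cosetSum (N := k + 3) (n := k) (by omega)
  have he := implements_eAct (N := k + 3) (i := k) (by omega)
  have he' := implements_eAct (N := k + 3) (i := k + 1) le_rfl
  have hcomm : symmetrizer e (k + 1) * e k * cosetSum e k * e (k + 1) ≡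
      symmetrizer e (k + 1) * (e k * e (k + 1)) * cosetSum e k [SMOD skeinRelations (k + 3)] := by
    simpa only [mul_one] using
      (((hS.mul he).mul hQ).mul he').mul_smodEq ((hS.mul (he.mul he')).mul hQ) (by
        rw [mul_assoc, ((isTemperleyLieb_eAct (k + 3)).cosetSum_commute le_rfl le_rfl).eq]
        simp only [mul_assoc]) 1
  rw [annularTraceₗ_eq_of_smodEq hcomm,
    annularTraceₗ_symmetrizer_mul_mul_cosetSum (by omega) le_rfl
      (mul_mem_closedSpan (e_mem_closedSpan (by omega)) (e_mem_closedSpan le_rfl)),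
    annularTraceₗ_mul_e_mul_e (symmetrizer_e_mem_closedSpan le_rfl)]

theorem annularTraceₗ_symmetrizer_mul_e (k : ℕ) :
    annularTraceₗ (k + 2) (symmetrizer e (k + 1) * e k) =
      C (d * quantumInt (k + 1) + A ^ 2 * quantumInt k) * annularTraceₗ k (symmetrizer e k) := by
  cases k with
  | zero =>
    have hone : symmetrizer e (0 + 1) = symmetrizer e 0 := mul_one _
    rw [hone, annularTraceₗ_mul_e (symmetrizer_e_mem_closedSpan le_rfl), quantumInt_one,
      quantumInt_zero, mul_one, mul_zero, add_zero]
  | succ l =>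
    rw [symmetrizer_add_two_mul, map_add, map_add, map_smul, map_smul,
      annularTraceₗ_symmetrizer_mul_cosetSum_mul (by omega) le_rfl,
      annularTraceₗ_symmetrizer_mul_e_mul_cosetSum_mul_e,
      annularTraceₗ_mul_e (symmetrizer_e_mem_closedSpan le_rfl), smul_eq_C_mul, smul_eq_C_mul,
      quantumInt_succ (l + 1)]
    simp only [C_add, C_mul, C_1]
    ring

theorem annularTraceₗ_symmetrizer_add_two (k : ℕ) :
    annularTraceₗ (k + 2) (symmetrizer e (k + 2)) =
      C (quantumInt (k + 2)) * (X * annularTraceₗ (k + 1) (symmetrizer e (k + 1)) -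
        C (quantumInt (k + 1)) * annularTraceₗ k (symmetrizer e k)) := by
  have hexpand := symmetrizer_add_two_mul k 1
  have hcoset := annularTraceₗ_symmetrizer_mul_cosetSum_mul (N := k + 2) (n := k + 1) (j := k)
    (by omega) le_rfl 1
  simp only [mul_one] at hexpand hcoset
  have hone := congrArg (C : K → K[X]) (quantumInt_succ (k + 1))
  have htwo := congrArg (C : K → K[X]) (quantumInt_add_two k)
  rw [hexpand, map_add, map_add, map_smul, map_smul, hcoset,
    annularTraceₗ_symmetrizer_mul_mul_cosetSum (by omega) le_rfl (e_mem_closedSpan le_rfl),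
    annularTraceₗ_symmetrizer_mul_e, annularTraceₗ_succ (symmetrizer_e_mem_closedSpan le_rfl),
    smul_eq_C_mul, smul_eq_C_mul]
  simp only [C_add, C_mul, C_neg, C_1] at hone htwo ⊢
  linear_combination C (quantumInt (k + 1)) * annularTraceₗ k (symmetrizer e k) * htwo -
    X * annularTraceₗ (k + 1) (symmetrizer e (k + 1)) * hone

theorem annularTraceₗ_symmetrizer (n : ℕ) :
    annularTraceₗ n (symmetrizer e n) = C (quantumFactorial n) * Chebyshev.S K (n : ℤ) := by
  induction n using Nat.twoStepInduction with
  | zero =>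
    rw [symmetrizer, ← diagram_nil, annularTraceₗ_diagram, annularBracket_nil,
      quantumFactorial_zero]
    simp
  | one =>
    rw [symmetrizer, cosetSum, mul_one, symmetrizer, ← diagram_nil, annularTraceₗ_diagram,
      annularBracket_nil, quantumFactorial_succ, quantumFactorial_zero, quantumInt_one]
    simp
  | more k ih0 ih1 =>
    rw [annularTraceₗ_symmetrizer_add_two, ih0, ih1, quantumFactorial_succ (k + 1),
      quantumFactorial_succ k]
    push_cast
    rw [Chebyshev.S_add_two]
    simp only [C_mul]
    ring

theorem jonesWenzl_zero_eq (n : ℕ) :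
    jonesWenzl 0 n = (quantumFactorial n)⁻¹ • symmetrizer e n := by
  simp only [jonesWenzl_eq, zero_add]

theorem annularTrace_jonesWenzl (n : ℕ) :
    annularTrace n (jonesWenzl 0 n) = Chebyshev.S K (n : ℤ) := by
  rw [jonesWenzl_zero_eq, ← annularTraceₗ_apply, map_smul, annularTraceₗ_symmetrizer,
    smul_eq_C_mul, ← mul_assoc, ← C_mul, inv_mul_cancel₀ (quantumFactorial_ne_zero n), C_1,
    one_mul]

theorem Delta_zero : Delta 0 = 1 := by
  rw [Delta, pow_zero, one_mul]
  exact div_self (A_pow_sub_inv_ne_zero two_ne_zero)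

theorem Delta_one : Delta 1 = d := by
  have h := A_pow_sub_inv_ne_zero two_ne_zero
  rw [Delta, div_eq_iff h, d]
  have := A_ne_zero
  field_simp
  ring

theorem Delta_add_two (n : ℕ) : Delta (n + 2) = d * Delta (n + 1) - Delta n := by
  have h := A_pow_sub_inv_ne_zero two_ne_zero
  have hA := A_ne_zero
  rw [Delta, Delta, Delta, div_eq_iff h, sub_mul, mul_assoc, div_mul_cancel₀ _ h,
    div_mul_cancel₀ _ h, d]
  field_simp
  ring

theorem eval_chebyshev_S (n : ℕ) : (Chebyshev.S K (n : ℤ)).eval d = Delta n := by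
  induction n using Nat.twoStepInduction with
  | zero => simp [Delta_zero]
  | one => simp [Delta_one]
  | more n ih0 ih1 =>
    push_cast at ih1 ⊢
    rw [Chebyshev.S_add_two, eval_sub, eval_mul, eval_X, ih0, ih1, Delta_add_two]

theorem Delta_ne_zero (n : ℕ) : Delta n ≠ 0 :=
  div_ne_zero (mul_ne_zero (pow_ne_zero _ (neg_ne_zero.2 one_ne_zero))
    (A_pow_sub_inv_ne_zero (by omega))) (A_pow_sub_inv_ne_zero two_ne_zero)

theorem symmetrizer_mul_cap_smodEq_zero {i : ℕ} (hi : i + 2 ≤ N) (w : List Slice) :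
    symmetrizer e N * diagram (.cap i :: w) ≡ 0 [SMOD skeinRelations N] := by
  have hS := Implements.symmetrizer (le_refl N)
  set y := diagram (.cap i :: w)
  have hzero : d • symmetrizer (eAct N) N (Submodule.Quotient.mk y) = 0 := by
    rw [← map_smul, ← Submodule.Quotient.mk_smul, ← e_mul_cap_smodEq hi w, ← implements_eAct hi,
      ← Module.End.mul_apply, (isTemperleyLieb_eAct N).symmetrizer_mul hi le_rfl,
      LinearMap.zero_apply]
  rw [SModEq, ← hS, (smul_eq_zero.1 hzero).resolve_left d_ne_zero, Submodule.Quotient.mk_zero]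

theorem exists_symmetrizer_mul_diagram_smodEq (h : Valid N w) (hw : width N w = N) :
    ∃ c : K, symmetrizer e N * diagram w ≡ c • symmetrizer e N [SMOD skeinRelations N] := by
  obtain ⟨c, r, hr, hrv, hrw, hc⟩ := h.isReducible
  have hmul : symmetrizer e N * diagram w ≡ c • (symmetrizer e N * diagram r)
      [SMOD skeinRelations N] := by
    have hS := Implements.symmetrizer (le_refl N)
    rw [SModEq, ← hS, hc, hS, mul_smul_comm]
  obtain rfl | ⟨i, v, rfl⟩ := hr.eq_nil_or_cap_cons (hrw.trans hw)
  · exact ⟨c, by simpa only [diagram_nil, mul_one] using hmul⟩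
  · have hzero := (symmetrizer_mul_cap_smodEq_zero hrv.1 v).smul c
    exact ⟨0, by simpa only [smul_zero, zero_smul] using hmul.trans hzero⟩

theorem exists_symmetrizer_mul_smodEq (hx : x ∈ closedSpan N) :
    ∃ c : K, symmetrizer e N * x ≡ c • symmetrizer e N [SMOD skeinRelations N] := by
  let mk := (skeinRelations N).mkQ
  have hmem : mk (symmetrizer e N * x) ∈ Submodule.span K {mk (symmetrizer e N)} := by
    refine closedSpan_le (p := (Submodule.span K {mk (symmetrizer e N)}).comap
      (mk ∘ₗ LinearMap.mulLeft K (symmetrizer e N))) (fun w h hw => ?_) hx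
    obtain ⟨c, hc⟩ := exists_symmetrizer_mul_diagram_smodEq h hw
    exact Submodule.mem_span_singleton.2 ⟨c, hc.symm⟩
  obtain ⟨c, hc⟩ := Submodule.mem_span_singleton.1 hmem
  exact ⟨c, hc.symm⟩

theorem valid_nestedCups (x y z : ℕ) :
    Valid (x + y) ((List.range z).map fun k => Slice.cup (y + k)) ∧
      width (x + y) ((List.range z).map fun k => Slice.cup (y + k)) = x + y + 2 * z := by
  induction z with
  | zero => exact ⟨trivial, rfl⟩
  | succ z ih =>
    rw [List.range_succ, List.map_append, valid_append, width_append, ih.2]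
    refine ⟨⟨ih.1, valid_singleton.2 ?_⟩, ?_⟩
    · simp only [Slice.Fits]
      omega
    · simp only [List.map_cons, List.map_nil, width_cons, width_nil, Slice.below]
      omega

theorem valid_nestedCaps (x y z : ℕ) :
    Valid (x + y + 2 * z) ((List.range z).reverse.map fun k => Slice.cap (y + k)) ∧
      width (x + y + 2 * z) ((List.range z).reverse.map fun k => Slice.cap (y + k)) = x + y := by
  induction z with
  | zero => exact ⟨trivial, rfl⟩
  | succ z ih =>
    rw [List.range_succ, List.reverse_append, List.reverse_singleton, List.singleton_append,
      List.map_cons, width_cons]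
    have hbelow : (Slice.cap (y + z)).below (x + y + 2 * (z + 1)) = x + y + 2 * z := by
      simp only [Slice.below]
      omega
    refine ⟨⟨?_, by rw [hbelow]; exact ih.1⟩, by rw [hbelow]; exact ih.2⟩
    simp only [Slice.Fits]
    omega

theorem exists_openTheta_eq (x y z : ℕ) :
    ∃ t ∈ closedSpan (x + y), openTheta x y z = jonesWenzl 0 (x + y) * t := by
  refine ⟨nestedCups y z * (jonesWenzl 0 (y + z) * jonesWenzl (y + z) (x + z)) * nestedCaps y z,
    ?_, by simp only [openTheta, mul_assoc]⟩
  exact diagram_mul_mul_diagram_mem_closedSpan (valid_nestedCups x y z).1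
    (valid_nestedCups x y z).2 (valid_nestedCaps x y z).1 (valid_nestedCaps x y z).2
    (mul_mem_closedSpan (jonesWenzl_mem_closedSpan (by omega))
      (jonesWenzl_mem_closedSpan (by omega)))

theorem exists_annularTheta_eq (x y z : ℕ) :
    ∃ c : K, annularTheta x y z = C c * Chebyshev.S K ((x + y : ℕ) : ℤ) := by
  obtain ⟨t, ht, hθ⟩ := exists_openTheta_eq x y z
  obtain ⟨c, hc⟩ := exists_symmetrizer_mul_smodEq ht
  refine ⟨c, ?_⟩
  rw [annularTheta, hθ, ← annularTrace_jonesWenzl, jonesWenzl_zero_eq, smul_mul_assoc,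
    ← annularTraceₗ_apply, ← annularTraceₗ_apply, map_smul, annularTraceₗ_eq_of_smodEq hc,
    map_smul, map_smul, smul_comm, smul_eq_C_mul c]

end

end ThetaNet

theorem mainTheorem3 (x y z : ℕ) :
    ThetaNet.annularTheta x y z =
        Polynomial.C (ThetaNet.planarTheta x y z / ThetaNet.Delta (x + y)) *
          Polynomial.Chebyshev.S ThetaNet.K ((x + y : ℕ) : ℤ) ∧
      ThetaNet.annularTrace (x + y) (ThetaNet.jonesWenzl 0 (x + y)) =
        Polynomial.Chebyshev.S ThetaNet.K ((x + y : ℕ) : ℤ) ∧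
      ThetaNet.planarTrace (x + y) (ThetaNet.jonesWenzl 0 (x + y)) = ThetaNet.Delta (x + y) ∧
      ThetaNet.Delta (x + y) ≠ 0 := by
  have hJ := ThetaNet.annularTrace_jonesWenzl (x + y)
  refine ⟨?_, hJ, ?_, ThetaNet.Delta_ne_zero _⟩
  · obtain ⟨c, hc⟩ := ThetaNet.exists_annularTheta_eq x y z
    have hp : ThetaNet.planarTheta x y z = c * ThetaNet.Delta (x + y) := by
      rw [ThetaNet.planarTheta, ThetaNet.planarTrace_eq_eval, ← ThetaNet.annularTheta, hc,
        Polynomial.eval_mul, Polynomial.eval_C, ThetaNet.eval_chebyshev_S]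
    rw [hp, mul_div_cancel_right₀ _ (ThetaNet.Delta_ne_zero _), hc]
  · rw [ThetaNet.planarTrace_eq_eval, hJ, ThetaNet.eval_chebyshev_S]
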